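/- **Setting.** A stream of $n\ge 1$ arms arrives in an arbitrary fixed order $1,\dots,n$. Arm $i$ has an unknown reward distribution $\nu_i$ supported on $[0,1]$ with mean $\mu_i$; the rewards of all pulls are independent, and each pull of arm $i$ has law $\nu_i$. Let $\varepsilon,\delta\in(0,1)$, let $C\ge 100$ be a constant, and put $$s_0=0,\qquad s_\ell=\frac{16}{\varepsilon^2}\log\Big(\frac{C}{\delta}\Big)2^\ell\ (\ell\ge1),\qquad \tau_j=\frac{32}{\varepsilon^2}\log\Big(\frac{Cj^2}{\delta}\Big)\ (j\ge1),$$ where $\log$ is the natural logarithm. Numbers of pulls are rounded up: an arm has been pulled $\lceil s_\ell\rceil$ times in total at the end of round $\ell$. **Algorithm.** Store arm $1$ as $o$, pull it $\lceil s_1\rceil$ times, let $\hat\mu_o$ be the empirical mean, and set $j=1$. For each arriving arm $i=2,\dots,n$: draw, independently of everything else, $\alpha=\varepsilon/4$ with probability $\frac1{\log j+1}$ and $\alpha=\varepsilon/2$ otherwise; then for rounds $\ell=1,2,\dots$ pull arm $i$ another $\lceil s_\ell\rceil-\lceil s_{\ell-1}\rceil$ times and let $\hat\mu_i$ be the empirical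 mean of all its pulls so far. - If $\hat\mu_i\ge\hat\mu_o+\alpha$ and $s_\ell>\tau_j$, replace the stored arm by $i$ (with estimate $\hat\mu_i$), reset $j=1$, and go to the next arm. - Otherwise, if $\hat\mu_i<\hat\mu_o+\alpha$, discard arm $i$, increase $j$ by $1$, and go to the next arm. - Otherwise go on to the next round. When the stream ends, return the index of the stored arm. **Theorem 1.** For every $C\ge100$ there is a constant $K>0$ depending only on $C$ such that, for all $\varepsilon,\delta\in(0,1)$, all $n\ge1$ and all such streams of arms, the algorithm has the following properties. 1. It makes a single pass and uses a single-arm memory: the pulls are made in the order of arrival of the arms, so an arm is pulled only when it arrives and is never pulled again once a later arm has been pulled. 2. With probability at least $1-\delta$, the returned arm $\hat\imath$ satisfies $\mu_{\hat\imath}\ge\max_i\mu_i-\varepsilon$. 3. The expected total number of pulls is at most $K\,\frac{n}{\varepsilon^2}\big(1+\log\frac1\delta\big)$; moreover, if $\delta\le\frac12$, it is at most $K\,\frac{n}{\varepsilon^2}\log\frac1\delta$, i.e. $O\big(\frac n{\varepsilon^2}\log\frac1\delta\big)$. -/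

import Mathlib

open MeasureTheory ProbabilityTheory

noncomputable section

namespace StreamingBAI

/-- Input parameters: approximation `ε`, confidence `δ`, and the constant `C ≥ 100`. -/
structure Params where
  ε : ℝ
  δ : ℝ
  C : ℝ
  ε_pos : 0 < ε
  ε_lt_one : ε < 1
  δ_pos : 0 < δ
  δ_lt_one : δ < 1
  C_ge : 100 ≤ C

namespace Params

/-- `s_ℓ = (16 / ε²) · log (C / δ) · 2 ^ ℓ` for `ℓ ≥ 1`, and `s_0 = 0`. -/
def s (p : Params) (l : ℕ) : ℝ :=
  if l = 0 then 0 else 16 / p.ε ^ 2 * Real.log (p.C / p.δ) * 2 ^ l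

/-- `τ_j = (32 / ε²) · log (C · j² / δ)`. -/
def τ (p : Params) (j : ℕ) : ℝ :=
  32 / p.ε ^ 2 * Real.log (p.C * (j : ℝ) ^ 2 / p.δ)

/-- The integer number of pulls that an arm has received at the end of round `ℓ`:
`s_ℓ` rounded up. -/
def cumPulls (p : Params) (l : ℕ) : ℕ := ⌈p.s l⌉₊

/-- The threshold `α` as a function of a number `u`. When `u` is uniform on `[0, 1]`, it is `ε / 4`
with probability `1 / (log j + 1)` and `ε / 2` otherwise. -/
def threshold (p : Params) (j : ℕ) (u : ℝ) : ℝ :=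
  if u ≤ 1 / (Real.log j + 1) then p.ε / 4 else p.ε / 2

lemma coeff_pos (p : Params) : 0 < 16 / p.ε ^ 2 * Real.log (p.C / p.δ) := by
  have h1 := p.ε_pos
  have h2 : 1 < p.C / p.δ := by
    rw [lt_div_iff₀ p.δ_pos]
    linarith [p.C_ge, p.δ_lt_one]
  have h3 := Real.log_pos h2
  positivity

lemma s_mono (p : Params) {a b : ℕ} (h : a ≤ b) : p.s a ≤ p.s b := by
  have hc := p.coeff_pos
  unfold s
  split_ifs with h1 h2
  · exact le_rfl
  · positivity
  · omega
  · exact mul_le_mul_of_nonneg_left (pow_le_pow_right₀ (by norm_num) h) hc.le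

lemma exists_lt_s (p : Params) (x : ℝ) : ∃ l : ℕ, x < p.s l := by
  obtain ⟨l, hl⟩ := pow_unbounded_of_one_lt
    (x / (16 / p.ε ^ 2 * Real.log (p.C / p.δ))) (one_lt_two : (1 : ℝ) < 2)
  refine ⟨l + 1, ?_⟩
  have hc := p.coeff_pos
  rw [div_lt_iff₀ hc] at hl
  have h2 : (0 : ℝ) < 2 ^ l := by positivity
  rw [s, if_neg (Nat.succ_ne_zero l), pow_succ 2 l]
  nlinarith [mul_pos hc h2]

/-- The first round at which `s_ℓ > τ_j`; used only to show that the comparison loop stops. -/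
def lastRound (p : Params) (j : ℕ) : ℕ := Nat.find (p.exists_lt_s (p.τ j))

lemma lt_lastRound (p : Params) {j l : ℕ} (h : p.s l ≤ p.τ j) : l < p.lastRound j := by
  by_contra hcon
  have h1 := p.s_mono (not_lt.mp hcon)
  have h2 : p.τ j < p.s (p.lastRound j) := Nat.find_spec (p.exists_lt_s (p.τ j))
  linarith

end Params

/-- Working record while one arm is being pulled: the number of times it has been pulled since
it arrived, the sum of the rewards obtained, and the chronological list of all arms pulled so far
during the whole execution (earliest first). -/
structure Tally (n : ℕ) where
  count : ℕ
  total : ℝ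
  log : List (Fin n)

/-- The estimated mean of the arm that is being pulled. -/
def Tally.mean {n : ℕ} (t : Tally n) : ℝ := t.total / t.count

/-- Pull arm `i` once. Here `X i m` is the reward of the `(m + 1)`-st pull of arm `i` in
the execution. -/
def pull {n : ℕ} (X : Fin n → ℕ → ℝ) (i : Fin n) (t : Tally n) : Tally n :=
  ⟨t.count + 1, t.total + X i (t.log.count i), t.log ++ [i]⟩

/-- Pull arm `i` the given number of times. -/
def pullTimes {n : ℕ} (X : Fin n → ℕ → ℝ) (i : Fin n) : ℕ → Tally n → Tally n
  | 0, t => t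
  | k + 1, t => pullTimes X i k (pull X i t)

open Classical in
/-- The inner `while` loop, entered at round `l`: the arriving arm `i` is compared with the
estimated mean `μo` of the stored arm, using threshold `α`. The boolean says whether arm `i`
replaces the stored arm. -/
def compareLoop {n : ℕ} (p : Params) (X : Fin n → ℕ → ℝ) (i : Fin n) (μo α : ℝ) (j : ℕ)
    (l : ℕ) (t : Tally n) : Bool × Tally n :=
  if (pullTimes X i (p.cumPulls l - p.cumPulls (l - 1)) t).mean ≥ μo + α ∧ p.s l > p.τ j then
    (true, pullTimes X i (p.cumPulls l - p.cumPulls (l - 1)) t)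
  else if (pullTimes X i (p.cumPulls l - p.cumPulls (l - 1)) t).mean < μo + α then
    (false, pullTimes X i (p.cumPulls l - p.cumPulls (l - 1)) t)
  else
    compareLoop p X i μo α j (l + 1) (pullTimes X i (p.cumPulls l - p.cumPulls (l - 1)) t)
termination_by p.lastRound j - l
decreasing_by
  rename_i h1 h2
  have h3 : p.s l ≤ p.τ j := by
    by_contra h
    exact h1 ⟨not_lt.mp h2, not_le.mp h⟩
  have h4 := p.lt_lastRound h3
  omega

/-- State of the algorithm between two arrivals: the index of the stored arm, its estimated mean,
the counter `j`, and the chronological list of all arms pulled so far. -/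
structure State (n : ℕ) where
  best : Fin n
  bestMean : ℝ
  j : ℕ
  log : List (Fin n)

/-- Processing of the arriving arm `i`; `U i` is the random number that selects `α`. -/
def step {n : ℕ} (p : Params) (X : Fin n → ℕ → ℝ) (U : Fin n → ℝ) (st : State n) (i : Fin n) :
    State n :=
  match compareLoop p X i st.bestMean (p.threshold st.j (U i)) st.j 1 ⟨0, 0, st.log⟩ with
  | (true, t) => ⟨i, t.mean, 1, t.log⟩
  | (false, t) => ⟨st.best, st.bestMean, st.j + 1, t.log⟩

/-- The state after the first arm has been stored and pulled `s_1` times. -/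
def initState {n : ℕ} [NeZero n] (p : Params) (X : Fin n → ℕ → ℝ) : State n :=
  ⟨0, (pullTimes X 0 (p.cumPulls 1) ⟨0, 0, []⟩).mean, 1,
    (pullTimes X 0 (p.cumPulls 1) ⟨0, 0, []⟩).log⟩

/-- The whole algorithm on a stream of `n ≥ 1` arms, which arrive in the order `0, 1, …, n - 1`,
with rewards `X` and internal random numbers `U`. The returned arm is the field `best` of
the final state, and its field `log` lists all the pulls that were made. -/
def run {n : ℕ} [NeZero n] (p : Params) (X : Fin n → ℕ → ℝ) (U : Fin n → ℝ) : State n :=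
  (List.finRange n).tail.foldl (step p X U) (initState p X)

/-- The mean of a reward distribution. -/
def mean (ν : Measure ℝ) : ℝ := ∫ x, x ∂ν

end StreamingBAI

end

/-! Acceptance happens only at the first round whose `s` exceeds `τ j`, and requires the averages at
the end of that round and of every earlier one to reach the stored estimate plus `α`. The next
(stored arm, estimate `m`, counter `j`) therefore depends only on the current one and on the data of
the arriving arm, which is independent of the past. Both probabilistic claims thus reduce to a
one-step drift bound for a potential, summed along the stream by `IsStream.lintegral_summaryRun_le`.
Below, `Λ = log (C / δ)` and `scale = Λ / ε ^ 2`.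

Cost. An arm with mean at most `m + 3ε/8` seldom survives the rounds when `α = ε/2`, so it costs
`O(scale)` in expectation. When `α = ε/4` it may use all rounds, at cost `O(scale * (1 + log j))`,
but this draw has probability `1 / (log j + 1)`. A better arm may also use all rounds, but with
probability at least `0.9 / (log j + 1)` it is accepted and resets `j` to `1`. The potential `150 *
scale * log j * (1 + log j)` makes that reset pay for the rounds, and it grows by only `O(scale)`
per rejection.

Correctness. Let `θ` be the best mean minus `5ε/8`. An error requires a final estimate below `θ`, or
a stored arm more than `ε` below the best with an estimate of at least `θ`. The first is unlikely:
estimates never decrease, and the best arm raises the estimate to `θ` unless one of its averages is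
low. For the second, a union bound over the `n` arms would lose a factor `n`. Instead, with `d = (θ
- m) / ε`, a bounded potential of `(d, j)` drops by at least `exp (-(Λ * |d|)) / (4 * j ^ 2)` at
every step, whatever the outcome. When `m` is above `θ` or not far below it, this drop, times the
weight `4 * exp (-(8 * Λ))`, pays for the Hoeffding probability of accepting a bad arm at level `θ`.
When `m` is far below `θ` compared with that arm, the arm is probably accepted with an honest
estimate, and the larger drop pays. The two errors total at most `15 * exp (-Λ) = 15 * δ / C ≤ δ`.
-/

noncomputable section

namespace StreamingBAI

/-! ### Deterministic description of a run -/

/-- The average of the first `N` entries of a reward sequence. -/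
def avg (x : ℕ → ℝ) (N : ℕ) : ℝ := (∑ r ∈ Finset.range N, x r) / N

lemma Params.one_le_lastRound (p : Params) {j : ℕ} (hj : 0 ≤ p.τ j) : 1 ≤ p.lastRound j := by
  have : p.s 0 ≤ p.τ j := by simpa [Params.s] using hj
  exact p.lt_lastRound this

lemma Params.cumPulls_mono (p : Params) {a b : ℕ} (h : a ≤ b) : p.cumPulls a ≤ p.cumPulls b :=
  Nat.ceil_mono (p.s_mono h)

lemma Params.cumPulls_zero (p : Params) : p.cumPulls 0 = 0 := by
  simp [Params.cumPulls, Params.s]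

lemma Params.τ_lt_s_lastRound (p : Params) (j : ℕ) : p.τ j < p.s (p.lastRound j) :=
  Nat.find_spec (p.exists_lt_s (p.τ j))

/-- The arriving arm passes every comparison against the level `v`. -/
def Passes (p : Params) (x : ℕ → ℝ) (v : ℝ) (j : ℕ) : Prop :=
  ∀ k ∈ Finset.Icc 1 (p.lastRound j), v ≤ avg x (p.cumPulls k)

open Classical in
/-- An upper bound for the number of pulls of an arriving arm compared with the level `v`. -/
def pullBound (p : Params) (x : ℕ → ℝ) (v : ℝ) (j : ℕ) : ℕ :=
  p.cumPulls 1 + ∑ k ∈ Finset.Ico 1 (p.lastRound j),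
    if v ≤ avg x (p.cumPulls k) then p.cumPulls (k + 1) - p.cumPulls k else 0

/-- The stored arm, its estimate, the counter `j`, and an upper bound on the number of pulls. -/
abbrev Summary (n : ℕ) : Type := Fin n × ℝ × ℕ × ℕ

open Classical in
/-- The effect of an arriving arm with reward sequence `ξ.1` and random number `ξ.2`. -/
def summaryStep {n : ℕ} (p : Params) (i : Fin n) (s : Summary n) (ξ : (ℕ → ℝ) × ℝ) : Summary n :=
  if Passes p ξ.1 (s.2.1 + p.threshold s.2.2.1 ξ.2) s.2.2.1 then
    (i, avg ξ.1 (p.cumPulls (p.lastRound s.2.2.1)), 1,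
      s.2.2.2 + pullBound p ξ.1 (s.2.1 + p.threshold s.2.2.1 ξ.2) s.2.2.1)
  else
    (s.1, s.2.1, s.2.2.1 + 1,
      s.2.2.2 + pullBound p ξ.1 (s.2.1 + p.threshold s.2.2.1 ξ.2) s.2.2.1)

/-- The working record after `c` pulls of arm `i`, on top of the list `log` of earlier pulls. -/
def tallyOf {n : ℕ} (X : Fin n → ℕ → ℝ) (i : Fin n) (log : List (Fin n)) (c : ℕ) : Tally n :=
  ⟨c, ∑ r ∈ Finset.range c, X i r, log ++ List.replicate c i⟩

lemma tallyOf_mean {n : ℕ} (X : Fin n → ℕ → ℝ) (i : Fin n) (log : List (Fin n)) (c : ℕ) :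
    (tallyOf X i log c).mean = avg (X i) c := rfl

/-- As `i` does not occur in `log`, the index `t.log.count i` that `pull` uses is the number of
pulls since arrival, so the rewards are read from `X i 0` onwards. -/
lemma pullTimes_tallyOf {n : ℕ} (X : Fin n → ℕ → ℝ) (i : Fin n) (log : List (Fin n))
    (hlog : i ∉ log) (k c : ℕ) :
    pullTimes X i k (tallyOf X i log c) = tallyOf X i log (c + k) := by
  induction k generalizing c with
  | zero => rfl
  | succ k ih =>
    have h : pull X i (tallyOf X i log c) = tallyOf X i log (c + 1) := by
      simp [pull, tallyOf, List.count_eq_zero.2 hlog, Finset.sum_range_succ, List.replicate_succ']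
    rw [pullTimes, h, ih]
    congr 1
    omega

/-- Induction on the distance `d` to `lastRound j`. Before that round `s l ≤ τ j` forbids
acceptance; at that round the loop must either accept or discard. Here `k` is the round at which it
stops. -/
lemma compareLoop_spec {n : ℕ} (p : Params) (X : Fin n → ℕ → ℝ) (i : Fin n) (μo α : ℝ) (j : ℕ)
    (log : List (Fin n)) (hlog : i ∉ log) (d : ℕ) :
    ∀ l, 1 ≤ l → l + d = p.lastRound j →
    ∃ k, l ≤ k ∧ k ≤ p.lastRound j ∧
      (compareLoop p X i μo α j l (tallyOf X i log (p.cumPulls (l - 1)))).2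
        = tallyOf X i log (p.cumPulls k) ∧
      (∀ k', l ≤ k' → k' < k → μo + α ≤ avg (X i) (p.cumPulls k')) ∧
      ((compareLoop p X i μo α j l (tallyOf X i log (p.cumPulls (l - 1)))).1 = true ∧
          k = p.lastRound j ∧ μo + α ≤ avg (X i) (p.cumPulls k) ∨
        (compareLoop p X i μo α j l (tallyOf X i log (p.cumPulls (l - 1)))).1 = false ∧
          avg (X i) (p.cumPulls k) < μo + α) := by
  induction d with
  | zero =>
    intro l hl hd
    have hT : pullTimes X i (p.cumPulls l - p.cumPulls (l - 1))
        (tallyOf X i log (p.cumPulls (l - 1))) = tallyOf X i log (p.cumPulls l) := by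
      rw [pullTimes_tallyOf X i log hlog, Nat.add_sub_cancel' (p.cumPulls_mono (Nat.sub_le l 1))]
    have hs : p.s l > p.τ j := by
      rw [show l = p.lastRound j by omega]
      exact p.τ_lt_s_lastRound j
    refine ⟨l, le_rfl, by omega, ?_⟩
    rw [compareLoop, hT, tallyOf_mean]
    by_cases h : μo + α ≤ avg (X i) (p.cumPulls l)
    · simp only [ge_iff_le, h, hs, and_self, if_true, true_and]
      exact ⟨fun k' h1 h2 => absurd h2 (by omega), Or.inl ⟨by omega, trivial⟩⟩
    · simp only [ge_iff_le, h, false_and, if_false, not_le.1 h, if_true, true_and]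
      exact ⟨fun k' h1 h2 => absurd h2 (by omega), Or.inr trivial⟩
  | succ d ih =>
    intro l hl hd
    have hT : pullTimes X i (p.cumPulls l - p.cumPulls (l - 1))
        (tallyOf X i log (p.cumPulls (l - 1))) = tallyOf X i log (p.cumPulls l) := by
      rw [pullTimes_tallyOf X i log hlog, Nat.add_sub_cancel' (p.cumPulls_mono (Nat.sub_le l 1))]
    have hs : ¬ p.s l > p.τ j := by
      have h : l < Nat.find (p.exists_lt_s (p.τ j)) := by
        change l < p.lastRound j
        omega
      exact Nat.find_min _ h
    rw [compareLoop, hT, tallyOf_mean]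
    by_cases h : μo + α ≤ avg (X i) (p.cumPulls l)
    · simp only [hs, and_false, if_false, not_lt.2 h]
      obtain ⟨k, h1, h2, h3, h4, h5⟩ := ih (l + 1) (by omega) (by omega)
      rw [Nat.add_sub_cancel] at h3 h5
      refine ⟨k, by omega, h2, h3, fun k' hk hk' => ?_, h5⟩
      rcases Nat.eq_or_lt_of_le hk with rfl | hk
      · exact h
      · exact h4 k' hk hk'
    · refine ⟨l, le_rfl, by omega, ?_⟩
      simp only [hs, and_false, if_false, not_le.1 h, if_true, true_and]
      exact ⟨fun k' h1 h2 => absurd h2 (by omega), Or.inr trivial⟩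

lemma cumPulls_eq_sum (p : Params) {k : ℕ} (hk : 1 ≤ k) :
    p.cumPulls k = p.cumPulls 1 + ∑ r ∈ Finset.Ico 1 k, (p.cumPulls (r + 1) - p.cumPulls r) := by
  induction k, hk using Nat.le_induction with
  | base => simp
  | succ k hk ih =>
    rw [Finset.sum_Ico_succ_top hk, ← add_assoc, ← ih,
      Nat.add_sub_cancel' (p.cumPulls_mono (Nat.le_succ k))]

lemma pullBound_le (p : Params) (x : ℕ → ℝ) (v : ℝ) {j : ℕ} (hL : 1 ≤ p.lastRound j) :
    pullBound p x v j ≤ p.cumPulls (p.lastRound j) := by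
  rw [cumPulls_eq_sum p hL, pullBound]
  gcongr with k hk
  split_ifs <;> simp

/-- The state `st` of the algorithm is described by the summary `s`. -/
def Describes {n : ℕ} (s : Summary n) (st : State n) : Prop :=
  st.best = s.1 ∧ st.bestMean = s.2.1 ∧ st.j = s.2.2.1 ∧ st.log.length ≤ s.2.2.2

lemma describes_step {n : ℕ} (p : Params) (X : Fin n → ℕ → ℝ) (U : Fin n → ℝ) (i : Fin n)
    {s : Summary n} {st : State n} (h : Describes s st) (hi : i ∉ st.log)
    (hL : 1 ≤ p.lastRound st.j) :
    Describes (summaryStep p i s (X i, U i)) (step p X U st i) ∧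
      ∃ k, (step p X U st i).log = st.log ++ List.replicate k i := by
  obtain ⟨best, m, j, N⟩ := s
  obtain ⟨h1, h2, h3, h4⟩ := h
  obtain ⟨best', m', j', log⟩ := st
  dsimp only at h1 h2 h3 h4 hi hL
  subst h1 h2 h3
  obtain ⟨k, hk1, hk2, hk3, hk4, hk5⟩ := compareLoop_spec p X i m' (p.threshold j' (U i)) j' log hi
    (p.lastRound j' - 1) 1 le_rfl (by omega)
  have ht : tallyOf X i log (p.cumPulls (1 - 1)) = ⟨0, 0, log⟩ := by
    simp [tallyOf, p.cumPulls_zero]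
  rw [ht] at hk3 hk5
  have hcost : p.cumPulls k ≤ pullBound p (X i) (m' + p.threshold j' (U i)) j' := by
    rw [cumPulls_eq_sum p hk1, pullBound]
    gcongr
    calc _ = ∑ r ∈ Finset.Ico 1 k, if m' + p.threshold j' (U i) ≤ avg (X i) (p.cumPulls r) then
            p.cumPulls (r + 1) - p.cumPulls r else 0 := by
          refine Finset.sum_congr rfl fun r hr => ?_
          rw [Finset.mem_Ico] at hr
          rw [if_pos (hk4 r hr.1 hr.2)]
      _ ≤ _ := Finset.sum_le_sum_of_subset (Finset.Ico_subset_Ico_right hk2)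
  rw [step, summaryStep]
  dsimp only
  revert hk3 hk5
  generalize compareLoop p X i m' (p.threshold j' (U i)) j' 1 ⟨0, 0, log⟩ = r
  obtain ⟨b, t⟩ := r
  rintro (rfl : t = _) hk5
  rcases hk5 with ⟨(rfl : b = true), rfl, h5⟩ | ⟨(rfl : b = false), h5⟩
  · have hP : Passes p (X i) (m' + p.threshold j' (U i)) j' := by
      intro r hr
      rw [Finset.mem_Icc] at hr
      rcases Nat.eq_or_lt_of_le hr.2 with rfl | hr'
      · exact h5
      · exact hk4 r hr.1 hr'
    rw [if_pos hP]
    refine ⟨⟨rfl, rfl, rfl, ?_⟩, _, rfl⟩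
    simp only [tallyOf, List.length_append, List.length_replicate]
    omega
  · have hP : ¬ Passes p (X i) (m' + p.threshold j' (U i)) j' := fun hP =>
      absurd (hP k (Finset.mem_Icc.2 ⟨hk1, hk2⟩)) (not_le.2 h5)
    rw [if_neg hP]
    refine ⟨⟨rfl, rfl, rfl, ?_⟩, _, rfl⟩
    simp only [tallyOf, List.length_append, List.length_replicate]
    omega

/-- The summary after the first arm has been stored. -/
def summaryInit {n : ℕ} [NeZero n] (p : Params) (x : ℕ → ℝ) : Summary n :=
  (0, avg x (p.cumPulls 1), 1, p.cumPulls 1)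

/-- The summary after the arms of the list `l` have arrived. -/
def summaryRun {n : ℕ} [NeZero n] (p : Params) (X : Fin n → ℕ → ℝ) (U : Fin n → ℝ)
    (l : List (Fin n)) : Summary n :=
  l.foldl (fun s i => summaryStep p i s (X i, U i)) (summaryInit p (X 0))

lemma summaryRun_append {n : ℕ} [NeZero n] (p : Params) (X : Fin n → ℕ → ℝ) (U : Fin n → ℝ)
    (l : List (Fin n)) (i : Fin n) :
    summaryRun p X U (l ++ [i]) = summaryStep p i (summaryRun p X U l) (X i, U i) := by
  simp [summaryRun]

lemma Params.τ_nonneg (p : Params) {j : ℕ} (hj : 1 ≤ j) : 0 ≤ p.τ j := by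
  have h1 := p.ε_pos
  have h2 : 1 ≤ p.C * (j : ℝ) ^ 2 / p.δ := by
    rw [le_div_iff₀ p.δ_pos]
    have : (1 : ℝ) ≤ j := by exact_mod_cast hj
    nlinarith [p.C_ge, p.δ_lt_one]
  have := Real.log_nonneg h2
  unfold Params.τ
  positivity

lemma summaryStep_counter {n : ℕ} (p : Params) (i : Fin n) (s : Summary n) (ξ : (ℕ → ℝ) × ℝ) :
    1 ≤ (summaryStep p i s ξ).2.2.1 := by
  rw [summaryStep]
  split_ifs <;> simp

lemma summaryRun_counter {n : ℕ} [NeZero n] (p : Params) (X : Fin n → ℕ → ℝ) (U : Fin n → ℝ)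
    (l : List (Fin n)) : 1 ≤ (summaryRun p X U l).2.2.1 := by
  induction l using List.reverseRecOn with
  | nil => exact le_rfl
  | append_singleton l i _ =>
    rw [summaryRun_append]
    exact summaryStep_counter p i _ _

/-- Increasing arrival order makes each arriving arm larger than every logged one. This gives both
the sorted log and the freshness hypothesis of `describes_step`. -/
lemma describes_foldl {n : ℕ} [NeZero n] (p : Params) (X : Fin n → ℕ → ℝ) (U : Fin n → ℝ)
    (l : List (Fin n)) (hl : (0 :: l).Pairwise (· < ·)) :
    Describes (summaryRun p X U l) (l.foldl (step p X U) (initState p X)) ∧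
      (l.foldl (step p X U) (initState p X)).log.Pairwise (· ≤ ·) ∧
      ∀ a ∈ (l.foldl (step p X U) (initState p X)).log, a ∈ 0 :: l := by
  induction l using List.reverseRecOn with
  | nil =>
    have h := pullTimes_tallyOf X 0 [] (by simp) (p.cumPulls 1) 0
    have h0 : tallyOf X 0 [] 0 = ⟨0, 0, []⟩ := by simp [tallyOf]
    rw [h0, zero_add] at h
    simp only [List.foldl_nil, initState, h, tallyOf_mean]
    refine ⟨⟨rfl, rfl, rfl, by simp [tallyOf, summaryRun, summaryInit]⟩, ?_, ?_⟩
    · simp [tallyOf, List.pairwise_replicate]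
    · simp [tallyOf]
  | append_singleton l i ih =>
    rw [← List.cons_append, List.pairwise_append] at hl
    obtain ⟨hl1, -, hl2⟩ := hl
    obtain ⟨ih1, ih2, ih3⟩ := ih hl1
    rw [List.foldl_append, List.foldl_cons, List.foldl_nil, summaryRun_append]
    have hj : 1 ≤ (l.foldl (step p X U) (initState p X)).j := by
      rw [ih1.2.2.1]
      exact summaryRun_counter p X U l
    have hlt : ∀ a ∈ (l.foldl (step p X U) (initState p X)).log, a < i := fun a ha =>
      hl2 a (ih3 a ha) i (by simp)
    obtain ⟨h1, k, h2⟩ := describes_step p X U i ih1 (fun hi => lt_irrefl _ (hlt i hi))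
      (p.one_le_lastRound (p.τ_nonneg hj))
    refine ⟨h1, ?_, ?_⟩
    · rw [h2, List.pairwise_append]
      refine ⟨ih2, by simp [List.pairwise_replicate], fun a ha b hb => ?_⟩
      rw [List.eq_of_mem_replicate hb]
      exact (hlt a ha).le
    · intro a ha
      rw [h2, List.mem_append] at ha
      rw [← List.cons_append, List.mem_append]
      rcases ha with ha | ha
      · exact Or.inl (ih3 a ha)
      · exact Or.inr (by simp [List.eq_of_mem_replicate ha])

lemma zero_cons_finRange_tail (n : ℕ) [NeZero n] :
    (0 : Fin n) :: (List.finRange n).tail = List.finRange n := by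
  obtain ⟨m, rfl⟩ := Nat.exists_eq_succ_of_ne_zero (NeZero.ne n)
  rw [List.finRange_succ]
  rfl

lemma run_spec {n : ℕ} [NeZero n] (p : Params) (X : Fin n → ℕ → ℝ) (U : Fin n → ℝ) :
    Describes (summaryRun p X U (List.finRange n).tail) (run p X U) ∧
      (run p X U).log.Pairwise (· ≤ ·) := by
  have h := describes_foldl p X U (List.finRange n).tail (by
    rw [zero_cons_finRange_tail]
    exact List.pairwise_lt_finRange n)
  exact ⟨h.1, h.2.1⟩

/-! ### Measurability of the state and independence of successive arms -/

section Measurability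

variable {Z γ : Type*} [MeasurableSpace Z] [MeasurableSpace γ]

/-- The number of rounds depends on the random counter. Since the counter is countable, it suffices
to fix its value. -/
lemma measurable_nat_index {f : ℕ → Z → γ} {g : Z → ℕ} (hg : Measurable g)
    (hf : ∀ j, Measurable (f j)) : Measurable fun z => f (g z) z :=
  (measurable_from_prod_countable_right (f := fun q : ℕ × Z => f q.1 q.2) hf).comp
    (hg.prodMk measurable_id)

@[fun_prop]
lemma measurable_avg (N : ℕ) : Measurable fun x : ℕ → ℝ => avg x N := by
  unfold avg
  fun_prop

@[fun_prop]
lemma measurable_threshold (p : Params) (j : ℕ) : Measurable (p.threshold j) := by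
  unfold Params.threshold
  exact Measurable.ite (measurableSet_le measurable_id measurable_const) measurable_const
    measurable_const

lemma measurableSet_passes (p : Params) (j : ℕ) {x : Z → ℕ → ℝ} {v : Z → ℝ} (hx : Measurable x)
    (hv : Measurable v) : MeasurableSet {z | Passes p (x z) (v z) j} := by
  unfold Passes
  simp only [Set.ofPred_forall]
  exact Finset.measurableSet_biInter _ fun k _ =>
    measurableSet_le hv ((measurable_avg _).comp hx)

lemma measurable_pullBound (p : Params) (j : ℕ) {x : Z → ℕ → ℝ} {v : Z → ℝ} (hx : Measurable x)
    (hv : Measurable v) : Measurable fun z => pullBound p (x z) (v z) j := by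
  unfold pullBound
  refine measurable_const.add (Finset.measurable_sum _ fun k _ => ?_)
  exact Measurable.ite (measurableSet_le hv ((measurable_avg _).comp hx)) measurable_const
    measurable_const

open Classical in
lemma measurable_summaryStep {n : ℕ} (p : Params) (i : Fin n) :
    Measurable fun z : Summary n × ((ℕ → ℝ) × ℝ) => summaryStep p i z.1 z.2 := by
  unfold summaryStep
  refine measurable_nat_index (g := fun z : Summary n × ((ℕ → ℝ) × ℝ) => z.1.2.2.1)
    (f := fun j z => if Passes p z.2.1 (z.1.2.1 + p.threshold j z.2.2) j then
      (i, avg z.2.1 (p.cumPulls (p.lastRound j)), 1,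
        z.1.2.2.2 + pullBound p z.2.1 (z.1.2.1 + p.threshold j z.2.2) j)
      else (z.1.1, z.1.2.1, j + 1,
        z.1.2.2.2 + pullBound p z.2.1 (z.1.2.1 + p.threshold j z.2.2) j))
    (by fun_prop) fun j => ?_
  have hv : Measurable fun z : Summary n × ((ℕ → ℝ) × ℝ) => z.1.2.1 + p.threshold j z.2.2 := by
    fun_prop
  have hx : Measurable fun z : Summary n × ((ℕ → ℝ) × ℝ) => z.2.1 := by fun_prop
  have hb := measurable_pullBound p j hx hv
  refine Measurable.ite (measurableSet_passes p j hx hv) ?_ ?_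
  · exact measurable_const.prodMk (((measurable_avg _).comp hx).prodMk (measurable_const.prodMk
      ((by fun_prop : Measurable fun z : Summary n × ((ℕ → ℝ) × ℝ) => z.1.2.2.2).add hb)))
  · exact (by fun_prop : Measurable fun z : Summary n × ((ℕ → ℝ) × ℝ) => z.1.1).prodMk
      ((by fun_prop : Measurable fun z : Summary n × ((ℕ → ℝ) × ℝ) => z.1.2.1).prodMk
      (measurable_const.prodMk
      ((by fun_prop : Measurable fun z : Summary n × ((ℕ → ℝ) × ℝ) => z.1.2.2.2).add hb)))

/-- The space `Z` is arbitrary so that the lemma also applies to the σ-algebra generated by the arms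
seen so far, which yields independence from the next arm. -/
lemma measurable_summaryRun {n : ℕ} [NeZero n] (p : Params) {X : Fin n → ℕ → Z → ℝ}
    {U : Fin n → Z → ℝ} (l : List (Fin n)) (hX : ∀ i ∈ 0 :: l, ∀ k, Measurable (X i k))
    (hU : ∀ i ∈ 0 :: l, Measurable (U i)) :
    Measurable fun z => summaryRun p (fun i k => X i k z) (fun i => U i z) l := by
  induction l using List.reverseRecOn with
  | nil =>
    have h0 : Measurable fun z => fun k => X 0 k z := measurable_pi_iff.2 (hX 0 (by simp))
    have h1 : Measurable fun z => avg (fun k => X 0 k z) (p.cumPulls 1) :=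
      (measurable_avg _).comp h0
    simp only [summaryRun, List.foldl_nil, summaryInit]
    exact measurable_const.prodMk (h1.prodMk measurable_const)
  | append_singleton l i ih =>
    simp only [summaryRun_append]
    have hi : Measurable fun z => fun k => X i k z := measurable_pi_iff.2 (hX i (by simp))
    have h1 := ih
      (fun a ha => hX a (by simp only [List.mem_cons, List.mem_append] at ha ⊢; tauto))
      (fun a ha => hU a (by simp only [List.mem_cons, List.mem_append] at ha ⊢; tauto))
    have h2 : Measurable fun z => ((fun k => X i k z, U i z) : (ℕ → ℝ) × ℝ) :=
      hi.prodMk (hU i (by simp))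
    have h3 := (measurable_summaryStep p i).comp (h1.prodMk h2)
    simp only [Function.comp_def] at h3
    exact h3

end Measurability

/-- Fubini for the product law: the past can be frozen while integrating over the data of the new
arm. -/
lemma lintegral_comp_of_indepFun {Ω α β : Type*} [MeasurableSpace Ω] [MeasurableSpace α]
    [MeasurableSpace β] {P : Measure Ω} [IsProbabilityMeasure P] {S : Ω → α} {ξ : Ω → β}
    (hS : Measurable S) (hξ : Measurable ξ) (h : IndepFun S ξ P) {f : α × β → ENNReal}
    (hf : Measurable f) :
    ∫⁻ ω, f (S ω, ξ ω) ∂P = ∫⁻ ω, ∫⁻ ω', f (S ω, ξ ω') ∂P ∂P := by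
  have h1 := h.map_prod_eq_prod_map_map hS.aemeasurable hξ.aemeasurable
  have : IsProbabilityMeasure (P.map S) := Measure.isProbabilityMeasure_map hS.aemeasurable
  have : IsProbabilityMeasure (P.map ξ) := Measure.isProbabilityMeasure_map hξ.aemeasurable
  rw [← lintegral_map hf (hS.prodMk hξ), h1, lintegral_prod _ hf.aemeasurable,
    lintegral_map hf.lintegral_prod_right' hS]
  refine lintegral_congr fun ω => ?_
  exact lintegral_map (hf.comp measurable_prodMk_left) hξ

/-- The rewards `x` and the random number `u` used for one arm with mean reward `μ`. -/
structure IsArm {Ω : Type*} [MeasurableSpace Ω] (P : Measure Ω) (μ : ℝ) (x : ℕ → Ω → ℝ)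
    (u : Ω → ℝ) : Prop where
  measurable_reward : ∀ k, Measurable (x k)
  measurable_number : Measurable u
  reward_mem : ∀ k, ∀ᵐ ω ∂P, x k ω ∈ Set.Icc (0 : ℝ) 1
  integral_reward : ∀ k, ∫ ω, x k ω ∂P = μ
  iIndepFun_reward : iIndepFun x P
  map_number : P.map u = volume.restrict (Set.Icc (0 : ℝ) 1)
  indepFun : IndepFun (fun ω k => x k ω) u P

/-- A stream of independent arms. -/
structure IsStream {n : ℕ} {Ω : Type*} [MeasurableSpace Ω] (P : Measure Ω) (ν : Fin n → Measure ℝ)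
    (X : Fin n → ℕ → Ω → ℝ) (U : Fin n → Ω → ℝ) : Prop where
  support : ∀ i, ∀ᵐ x ∂(ν i), x ∈ Set.Icc (0 : ℝ) 1
  measurable_reward : ∀ i k, Measurable (X i k)
  measurable_number : ∀ i, Measurable (U i)
  map_reward : ∀ i k, P.map (X i k) = ν i
  map_number : ∀ i, P.map (U i) = volume.restrict (Set.Icc (0 : ℝ) 1)
  iIndepFun : iIndepFun (Sum.elim (fun q : Fin n × ℕ => X q.1 q.2) U) P

section Stream

variable {n : ℕ} {Ω : Type*} {X : Fin n → ℕ → Ω → ℝ} {U : Fin n → Ω → ℝ}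

/-- The σ-algebra generated by the random variables with index in `A`. -/
@[reducible]
def sigmaOf (X : Fin n → ℕ → Ω → ℝ) (U : Fin n → Ω → ℝ) (A : Set ((Fin n × ℕ) ⊕ Fin n)) :
    MeasurableSpace Ω :=
  ⨆ q ∈ A, MeasurableSpace.comap (Sum.elim (fun q : Fin n × ℕ => X q.1 q.2) U q) inferInstance

lemma measurable_sigmaOf {A : Set ((Fin n × ℕ) ⊕ Fin n)} {q : (Fin n × ℕ) ⊕ Fin n} (hq : q ∈ A) :
    Measurable[sigmaOf X U A] (Sum.elim (fun q : Fin n × ℕ => X q.1 q.2) U q) := by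
  rw [measurable_iff_comap_le]
  exact le_iSup₂_of_le q hq le_rfl

variable [MeasurableSpace Ω] {P : Measure Ω} {ν : Fin n → Measure ℝ}

lemma IsStream.measurable (h : IsStream P ν X U) (q : (Fin n × ℕ) ⊕ Fin n) :
    Measurable (Sum.elim (fun q : Fin n × ℕ => X q.1 q.2) U q) := by
  cases q with
  | inl q => exact h.measurable_reward q.1 q.2
  | inr i => exact h.measurable_number i

lemma IsStream.indepFun_of_disjoint (h : IsStream P ν X U) {A B : Set ((Fin n × ℕ) ⊕ Fin n)}
    (hAB : Disjoint A B) {α β : Type*} [mα : MeasurableSpace α] [mβ : MeasurableSpace β]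
    {f : Ω → α} {g : Ω → β} (hf : Measurable[sigmaOf X U A] f)
    (hg : Measurable[sigmaOf X U B] g) : IndepFun f g P := by
  rw [IndepFun_iff_Indep]
  have h1 := indep_iSup_of_disjoint (fun q => (h.measurable q).comap_le) h.iIndepFun.iIndep hAB
  exact indep_of_indep_of_le_left (indep_of_indep_of_le_right h1 hg.comap_le) hf.comap_le

lemma IsStream.isArm (h : IsStream P ν X U) (i : Fin n) :
    IsArm P (mean (ν i)) (X i) (U i) where
  measurable_reward := h.measurable_reward i
  measurable_number := h.measurable_number i
  reward_mem k := by
    have h1 := h.support i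
    rw [← h.map_reward i k] at h1
    exact ae_of_ae_map (h.measurable_reward i k).aemeasurable h1
  integral_reward k := by
    rw [mean, ← h.map_reward i k]
    exact (integral_map (h.measurable_reward i k).aemeasurable
      measurable_id.aestronglyMeasurable).symm
  iIndepFun_reward := h.iIndepFun.precomp (g := fun k => Sum.inl (i, k)) fun a b hab => by
    simpa using hab
  map_number := h.map_number i
  indepFun := by
    refine h.indepFun_of_disjoint (A := Set.range Sum.inl) (B := Set.range Sum.inr)
      Set.isCompl_range_inl_range_inr.disjoint ?_ ?_
    · exact @measurable_pi_lambda _ _ _ (sigmaOf X U _) _ _ fun k =>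
        measurable_sigmaOf (X := X) (U := U) (q := Sum.inl (i, k)) ⟨_, rfl⟩
    · exact measurable_sigmaOf (X := X) (U := U) (q := Sum.inr i) ⟨_, rfl⟩

lemma IsStream.indepFun_summaryRun [NeZero n] (h : IsStream P ν X U) (p : Params)
    (l : List (Fin n)) {i : Fin n} (hi : i ∉ 0 :: l) :
    IndepFun (fun ω => summaryRun p (fun i k => X i k ω) (fun i => U i ω) l)
      (fun ω => ((fun k => X i k ω, U i ω) : (ℕ → ℝ) × ℝ)) P := by
  refine h.indepFun_of_disjoint (A := {q | Sum.elim Prod.fst id q ∈ 0 :: l})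
    (B := {q | Sum.elim Prod.fst id q = i}) ?_ ?_ ?_
  · rw [Set.disjoint_left]
    rintro q hq rfl
    exact hi hq
  · exact @measurable_summaryRun _ (sigmaOf X U _) _ _ p _ _ l
      (fun a ha k => measurable_sigmaOf (X := X) (U := U) (q := Sum.inl (a, k)) ha)
      (fun a ha => measurable_sigmaOf (X := X) (U := U) (q := Sum.inr a) ha)
  · have h1 : Measurable[sigmaOf X U {q | Sum.elim Prod.fst id q = i}] (fun ω k => X i k ω) :=
      @measurable_pi_lambda Ω ℕ (fun _ => ℝ) (sigmaOf X U _) _ _ fun k =>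
        measurable_sigmaOf (X := X) (U := U) (q := Sum.inl (i, k)) rfl
    have h2 : Measurable[sigmaOf X U {q | Sum.elim Prod.fst id q = i}] (U i) :=
      measurable_sigmaOf (X := X) (U := U) (q := Sum.inr i) rfl
    exact h1.prodMk h2

variable [IsProbabilityMeasure P]

lemma IsStream.lintegral_summaryRun_append [NeZero n] (h : IsStream P ν X U) (p : Params)
    (l : List (Fin n)) {i : Fin n} (hi : i ∉ 0 :: l) {G : Summary n → ENNReal}
    (hG : Measurable G) :
    ∫⁻ ω, G (summaryRun p (fun i k => X i k ω) (fun i => U i ω) (l ++ [i])) ∂P =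
      ∫⁻ ω, ∫⁻ ω', G (summaryStep p i (summaryRun p (fun i k => X i k ω) (fun i => U i ω) l)
        (fun k => X i k ω', U i ω')) ∂P ∂P := by
  simp only [summaryRun_append]
  exact lintegral_comp_of_indepFun
    (measurable_summaryRun p l (fun i _ => h.measurable_reward i) (fun i _ => h.measurable_number i))
    ((measurable_pi_lambda _ (h.measurable_reward i)).prodMk (h.measurable_number i))
    (h.indepFun_summaryRun p l hi) (hG.comp (measurable_summaryStep p i))

/-- Additive drift: the one-step bound holds for every frozen state, hence on average. It is used
with `c` of order `scale` for the cost and with `c = 0`, a supermartingale, for the risk. -/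
lemma IsStream.lintegral_summaryRun_le [NeZero n] (h : IsStream P ν X U) (p : Params)
    {G : Summary n → ENNReal} (hG : Measurable G) (c : ENNReal)
    (hstep : ∀ i s, 1 ≤ s.2.2.1 →
      ∫⁻ ω, G (summaryStep p i s (fun k => X i k ω, U i ω)) ∂P ≤ G s + c)
    (l : List (Fin n)) (hl : (0 :: l).Nodup) :
    ∫⁻ ω, G (summaryRun p (fun i k => X i k ω) (fun i => U i ω) l) ∂P ≤
      ∫⁻ ω, G (summaryInit p fun k => X 0 k ω) ∂P + l.length * c := by
  induction l using List.reverseRecOn with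
  | nil => simp [summaryRun]
  | append_singleton l i ih =>
    rw [← List.cons_append, List.nodup_append] at hl
    have hi : i ∉ 0 :: l := fun hi => hl.2.2 i hi i (by simp) rfl
    rw [h.lintegral_summaryRun_append p l hi hG]
    calc _ ≤ ∫⁻ ω, (G (summaryRun p (fun i k => X i k ω) (fun i => U i ω) l) + c) ∂P :=
          lintegral_mono fun ω => hstep i _ (summaryRun_counter p _ _ l)
      _ = ∫⁻ ω, G (summaryRun p (fun i k => X i k ω) (fun i => U i ω) l) ∂P + c := by
          rw [lintegral_add_right _ measurable_const, lintegral_const, measure_univ, mul_one]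
      _ ≤ _ := by
          grw [ih hl.1]
          rw [List.length_append, List.length_singleton, Nat.cast_add, Nat.cast_one, add_mul,
            one_mul, add_assoc]

end Stream

/-! ### Hoeffding bounds for averages -/

section Hoeffding

variable {Ω : Type*} [MeasurableSpace Ω] {P : Measure Ω} [IsProbabilityMeasure P]
  {μ : ℝ} {x : ℕ → Ω → ℝ} {u : Ω → ℝ}

lemma IsArm.hasSubgaussianMGF (h : IsArm P μ x u) (k : ℕ) :
    HasSubgaussianMGF (fun ω => x k ω - μ) (1 / 4) P := by
  have h1 := hasSubgaussianMGF_of_mem_Icc (h.measurable_reward k).aemeasurable (h.reward_mem k)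
  rw [h.integral_reward k] at h1
  convert h1 using 1
  ext
  norm_num

lemma measure_mul_le_sum {y : ℕ → Ω → ℝ} (hind : iIndepFun y P)
    (hy : ∀ k, HasSubgaussianMGF (y k) (1 / 4) P) (N : ℕ) {t : ℝ} (ht : 0 ≤ t) :
    P {ω | N * t ≤ ∑ r ∈ Finset.range N, y r ω} ≤ ENNReal.ofReal (Real.exp (-(2 * N * t ^ 2))) := by
  have h1 := HasSubgaussianMGF.measure_sum_range_ge_le_of_iIndepFun hind (n := N)
    (fun i _ => hy i) (ε := N * t) (by positivity)
  rw [← ofReal_measureReal]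
  refine ENNReal.ofReal_le_ofReal (h1.trans (Real.exp_le_exp.2 ?_))
  rcases Nat.eq_zero_or_pos N with rfl | hN
  · simp
  · have : (0 : ℝ) < N := by exact_mod_cast hN
    apply le_of_eq
    push_cast
    field_simp
    ring

lemma IsArm.measure_le_avg (h : IsArm P μ x u) (N : ℕ) {t : ℝ} (ht : 0 ≤ t) :
    P {ω | μ + t ≤ avg (fun k => x k ω) N} ≤ ENNReal.ofReal (Real.exp (-(2 * N * t ^ 2))) := by
  rcases Nat.eq_zero_or_pos N with rfl | hN
  · simpa using prob_le_one
  have hN' : (0 : ℝ) < N := by exact_mod_cast hN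
  refine (measure_mono ?_).trans (measure_mul_le_sum (y := fun k ω => x k ω - μ)
    (h.iIndepFun_reward.comp (fun _ z => z - μ) (fun _ => by fun_prop)) h.hasSubgaussianMGF N ht)
  intro ω hω
  simp only [Set.mem_ofPred_eq, avg, le_div_iff₀ hN', Finset.sum_sub_distrib, Finset.sum_const,
    Finset.card_range, nsmul_eq_mul] at hω ⊢
  linarith

lemma IsArm.measure_avg_le (h : IsArm P μ x u) (N : ℕ) {t : ℝ} (ht : 0 ≤ t) :
    P {ω | avg (fun k => x k ω) N ≤ μ - t} ≤ ENNReal.ofReal (Real.exp (-(2 * N * t ^ 2))) := by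
  rcases Nat.eq_zero_or_pos N with rfl | hN
  · simpa using prob_le_one
  have hN' : (0 : ℝ) < N := by exact_mod_cast hN
  refine (measure_mono ?_).trans (measure_mul_le_sum (y := fun k ω => -(x k ω - μ))
    (h.iIndepFun_reward.comp (fun _ z => -(z - μ)) (fun _ => by fun_prop))
    (fun k => (h.hasSubgaussianMGF k).neg) N ht)
  intro ω hω
  simp only [Set.mem_ofPred_eq, avg, div_le_iff₀ hN', Finset.sum_neg_distrib,
    Finset.sum_sub_distrib, Finset.sum_const, Finset.card_range, nsmul_eq_mul] at hω ⊢
  linarith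

end Hoeffding

/-! ### Sizes of the rounds and the resulting deviation bounds -/

namespace Params

/-- `log (C / δ)`. -/
def Λ (p : Params) : ℝ := Real.log (p.C / p.δ)

/-- The basic scale `log (C / δ) / ε²` of the numbers of pulls. -/
def scale (p : Params) : ℝ := p.Λ / p.ε ^ 2

lemma four_le_Λ (p : Params) : 4 ≤ p.Λ := by
  have h0 := p.δ_pos
  have h1 : (100 : ℝ) ≤ p.C / p.δ := by
    rw [le_div_iff₀ h0]
    nlinarith [p.C_ge, p.δ_lt_one]
  rw [Λ, Real.le_log_iff_exp_le (by linarith)]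
  refine le_trans ?_ h1
  have h2 := Real.exp_one_lt_d9
  have h3 : Real.exp 4 = Real.exp 1 ^ 4 := by rw [← Real.exp_nat_mul]; norm_num
  have h4 : Real.exp 1 ^ 4 ≤ 2.8 ^ 4 := by
    gcongr
    linarith
  rw [h3]
  exact h4.trans (by norm_num)

lemma exp_neg_Λ (p : Params) : Real.exp (-p.Λ) = p.δ / p.C := by
  have h1 := p.δ_pos
  have h2 := p.C_ge
  rw [Real.exp_neg, Λ, Real.exp_log (by positivity), inv_div]

lemma exp_neg_Λ_le (p : Params) : Real.exp (-p.Λ) ≤ 1 / 100 := by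
  have h2 := p.C_ge
  rw [exp_neg_Λ, div_le_div_iff₀ (by linarith) (by norm_num)]
  nlinarith [p.δ_lt_one]

lemma four_le_scale (p : Params) : 4 ≤ p.scale := by
  have h1 := p.ε_pos
  have h2 := p.ε_lt_one
  rw [scale, le_div_iff₀ (by positivity)]
  nlinarith [p.four_le_Λ]

lemma s_eq (p : Params) {l : ℕ} (hl : 1 ≤ l) : p.s l = 16 * p.scale * 2 ^ l := by
  rw [s, if_neg (by omega), scale, Λ]
  ring

lemma τ_eq (p : Params) {j : ℕ} (hj : 1 ≤ j) :
    p.τ j = 32 / p.ε ^ 2 * (p.Λ + 2 * Real.log j) := by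
  have h1 := p.δ_pos
  have h2 := p.C_ge
  have h3 : (0 : ℝ) < j := by exact_mod_cast hj
  rw [τ, Λ, mul_div_right_comm, Real.log_mul (by positivity) (by positivity), Real.log_pow]
  norm_num

lemma log_counter_nonneg (j : ℕ) : 0 ≤ Real.log j := Real.log_natCast_nonneg j

lemma τ_le (p : Params) {j : ℕ} (hj : 1 ≤ j) : p.τ j ≤ 32 * p.scale * (1 + 2 * Real.log j) := by
  rw [p.τ_eq hj, scale]
  have h1 := p.ε_pos
  have h2 := p.four_le_Λ
  have h3 := log_counter_nonneg j
  rw [show 32 * (p.Λ / p.ε ^ 2) * (1 + 2 * Real.log j)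
    = 32 / p.ε ^ 2 * (p.Λ + 2 * (p.Λ * Real.log j)) by ring]
  have : 0 ≤ 32 / p.ε ^ 2 := by positivity
  refine mul_le_mul_of_nonneg_left ?_ this
  nlinarith

lemma s_le_cumPulls (p : Params) (l : ℕ) : p.s l ≤ p.cumPulls l := Nat.le_ceil _

lemma cumPulls_le (p : Params) (l : ℕ) : (p.cumPulls l : ℝ) ≤ p.s l + 1 := by
  have h : 0 ≤ p.s l := by simpa [s] using p.s_mono (Nat.zero_le l)
  exact (Nat.ceil_lt_add_one h).le

lemma cumPulls_one_le (p : Params) : (p.cumPulls 1 : ℝ) ≤ 33 * p.scale := by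
  have := p.cumPulls_le 1
  rw [p.s_eq le_rfl] at this
  linarith [p.four_le_scale]

lemma cumPulls_sub_le (p : Params) {k : ℕ} (hk : 1 ≤ k) :
    ((p.cumPulls (k + 1) - p.cumPulls k : ℕ) : ℝ) ≤ 17 * p.scale * 2 ^ k := by
  rw [Nat.cast_sub (p.cumPulls_mono (Nat.le_succ k))]
  have h1 := p.cumPulls_le (k + 1)
  have h2 := p.s_le_cumPulls k
  rw [p.s_eq (by omega), pow_succ] at h1
  rw [p.s_eq hk] at h2
  have h3 := p.four_le_scale
  have h4 : (1 : ℝ) ≤ 2 ^ k := one_le_pow₀ (by norm_num)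
  nlinarith

lemma cumPulls_lastRound_le (p : Params) {j : ℕ} (hj : 1 ≤ j) :
    (p.cumPulls (p.lastRound j) : ℝ) ≤ 130 * p.scale * (1 + Real.log j) := by
  -- This puts the last round at `2` or later, so the preceding round has `s k ≤ τ j` with `k ≥ 1`,
  -- and `s` exactly doubles from there.
  have h1 : p.s 1 ≤ p.τ j := by
    rw [p.s_eq le_rfl, p.τ_eq hj, scale]
    have : 0 ≤ 32 / p.ε ^ 2 := by have := p.ε_pos; positivity
    have h3 := mul_nonneg this (log_counter_nonneg j)
    have h4 : 16 * (p.Λ / p.ε ^ 2) * 2 ^ 1 = 32 / p.ε ^ 2 * p.Λ := by ring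
    rw [h4]
    nlinarith
  have h2 := p.lt_lastRound h1
  obtain ⟨k, hk⟩ : ∃ k, p.lastRound j = k + 1 := ⟨p.lastRound j - 1, by omega⟩
  have h3 : p.s k ≤ p.τ j := by
    have h : k < Nat.find (p.exists_lt_s (p.τ j)) := by
      change k < p.lastRound j
      omega
    exact not_lt.1 (Nat.find_min _ h)
  have h4 := p.cumPulls_le (k + 1)
  rw [p.s_eq (by omega), pow_succ] at h4
  rw [p.s_eq (by omega)] at h3
  rw [hk]
  have h5 := p.τ_le hj
  have h6 := p.four_le_scale
  have h7 := mul_nonneg (by linarith : 0 ≤ p.scale) (log_counter_nonneg j)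
  nlinarith

lemma exp_deviation_le (p : Params) {k : ℕ} (hk : 1 ≤ k) (x : ℝ) :
    Real.exp (-(2 * p.cumPulls k * (x * p.ε) ^ 2)) ≤ Real.exp (-(32 * p.Λ * 2 ^ k * x ^ 2)) := by
  have h1 := p.s_le_cumPulls k
  rw [p.s_eq hk, scale] at h1
  have h2 := p.ε_pos
  refine Real.exp_le_exp.2 (neg_le_neg ?_)
  calc 32 * p.Λ * 2 ^ k * x ^ 2
      = 2 * (16 * (p.Λ / p.ε ^ 2) * 2 ^ k) * (x * p.ε) ^ 2 := by
        field_simp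
        ring
    _ ≤ _ := by gcongr

lemma exp_deviation_lastRound_le (p : Params) {j : ℕ} (hj : 1 ≤ j) (x : ℝ) :
    Real.exp (-(2 * p.cumPulls (p.lastRound j) * (x * p.ε) ^ 2)) ≤
      Real.exp (-(64 * x ^ 2 * (p.Λ + 2 * Real.log j))) := by
  have h1 := (p.τ_lt_s_lastRound j).le.trans (p.s_le_cumPulls _)
  rw [p.τ_eq hj] at h1
  have h2 := p.ε_pos
  refine Real.exp_le_exp.2 (neg_le_neg ?_)
  calc 64 * x ^ 2 * (p.Λ + 2 * Real.log j)
      = 2 * (32 / p.ε ^ 2 * (p.Λ + 2 * Real.log j)) * (x * p.ε) ^ 2 := by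
        field_simp
        ring
    _ ≤ _ := by gcongr

/-- The exponent is at least `Λ * 2 ^ (k - 1) ≥ Λ * k`, so failures over the rounds are dominated by
a geometric series. -/
lemma exp_deviation_eighth_le (p : Params) {k : ℕ} (hk : 1 ≤ k) :
    Real.exp (-(2 * p.cumPulls k * (p.ε / 8) ^ 2)) ≤ Real.exp (-p.Λ) ^ k := by
  have h := p.exp_deviation_le hk (1 / 8)
  rw [one_div_mul_eq_div] at h
  refine h.trans ?_
  rw [← Real.exp_nat_mul]
  refine Real.exp_le_exp.2 ?_
  obtain ⟨m, rfl⟩ : ∃ m, k = m + 1 := ⟨k - 1, by omega⟩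
  have h1 : ((m + 1 : ℕ) : ℝ) ≤ 2 ^ m := by exact_mod_cast Nat.lt_two_pow_self
  have h2 := p.four_le_Λ
  rw [pow_succ]
  nlinarith

end Params

lemma sum_pow_Icc_le {r : ℝ} (h0 : 0 ≤ r) (h1 : r ≤ 1 / 2) (L : ℕ) :
    ∑ k ∈ Finset.Icc 1 L, r ^ k ≤ 2 * r := by
  have h2 : ∑ k ∈ Finset.Icc 1 L, r ^ k = r * ∑ k ∈ Finset.range L, r ^ k := by
    rw [Finset.range_eq_Ico, Finset.mul_sum, ← Finset.Ico_add_one_right_eq_Icc,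
      ← Finset.sum_Ico_add' _ 0 L 1]
    exact Finset.sum_congr rfl fun k _ => pow_succ' r k
  have h3 := geom_sum_mul_neg r L
  have h4 : ∑ k ∈ Finset.range L, r ^ k ≤ 2 := by
    have : 0 ≤ ∑ k ∈ Finset.range L, r ^ k := Finset.sum_nonneg fun k _ => pow_nonneg h0 k
    nlinarith [pow_nonneg h0 L]
  rw [h2]
  nlinarith

/-! ### Behaviour of one arriving arm against a fixed level -/

section Arm

variable {Ω : Type*} [MeasurableSpace Ω] {P : Measure Ω}
  {μ : ℝ} {x : ℕ → Ω → ℝ} {u : Ω → ℝ}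

lemma IsArm.measure_number_le (h : IsArm P μ x u) {a : ℝ} (h1 : a ≤ 1) :
    P {ω | u ω ≤ a} = ENNReal.ofReal a := by
  have h2 := Measure.map_apply (μ := P) h.measurable_number (measurableSet_Iic (a := a))
  rw [h.map_number, Measure.restrict_apply measurableSet_Iic] at h2
  have h3 : Set.Iic a ∩ Set.Icc 0 1 = Set.Icc 0 a := by
    ext z
    simp only [Set.mem_inter_iff, Set.mem_Iic, Set.mem_Icc]
    constructor
    · rintro ⟨h3, h4, h5⟩
      exact ⟨h4, h3⟩
    · rintro ⟨h3, h4⟩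
      exact ⟨h4, h3, h4.trans h1⟩
  rw [h3, Real.volume_Icc, sub_zero] at h2
  exact h2.symm

variable [IsProbabilityMeasure P]

/-- All averages taken up to the last round are above `μ - ε / 8`. -/
def NeverLow (p : Params) (μ : ℝ) (x : ℕ → ℝ) (j : ℕ) : Prop :=
  ∀ k ∈ Finset.Icc 1 (p.lastRound j), μ - p.ε / 8 < avg x (p.cumPulls k)

lemma IsArm.measure_not_neverLow_le (h : IsArm P μ x u) (p : Params) (j : ℕ) :
    P {ω | ¬ NeverLow p μ (fun k => x k ω) j} ≤ ENNReal.ofReal (2 * Real.exp (-p.Λ)) := by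
  have h1 : {ω | ¬ NeverLow p μ (fun k => x k ω) j} ⊆ ⋃ k ∈ Finset.Icc 1 (p.lastRound j),
      {ω | avg (fun k => x k ω) (p.cumPulls k) ≤ μ - p.ε / 8} := by
    intro ω hω
    simp only [NeverLow, Set.mem_ofPred_eq, not_forall, not_lt] at hω
    simpa using hω
  calc _ ≤ _ := measure_mono h1
    _ ≤ ∑ k ∈ Finset.Icc 1 (p.lastRound j), _ := measure_biUnion_finset_le _ _
    _ ≤ ∑ k ∈ Finset.Icc 1 (p.lastRound j), ENNReal.ofReal (Real.exp (-p.Λ) ^ k) :=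
        Finset.sum_le_sum fun k hk => (h.measure_avg_le _ (by have := p.ε_pos; positivity)).trans
          (ENNReal.ofReal_le_ofReal (p.exp_deviation_eighth_le (Finset.mem_Icc.1 hk).1))
    _ = ENNReal.ofReal (∑ k ∈ Finset.Icc 1 (p.lastRound j), Real.exp (-p.Λ) ^ k) :=
        (ENNReal.ofReal_sum_of_nonneg fun k _ => by positivity).symm
    _ ≤ _ := ENNReal.ofReal_le_ofReal (sum_pow_Icc_le (Real.exp_pos _).le
        (p.exp_neg_Λ_le.trans (by norm_num)) _)

/-- Round `k + 1` costs at most `17 * scale * 2 ^ k` and is reached with probability at most `exp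
(-Λ) ^ k`. The resulting series of ratio `2 * exp (-Λ) ≤ 1 / 50` adds less than `17 * scale` to the
`33 * scale` of the first round. -/
lemma IsArm.lintegral_pullBound_le (h : IsArm P μ x u) (p : Params) {v : ℝ}
    (hv : μ + p.ε / 8 ≤ v) (j : ℕ) :
    ∫⁻ ω, (pullBound p (fun k => x k ω) v j : ENNReal) ∂P ≤ ENNReal.ofReal (50 * p.scale) := by
  classical
  have hR := p.four_le_scale
  have hset : ∀ k, MeasurableSet {ω | v ≤ avg (fun k => x k ω) (p.cumPulls k)} := fun k =>
    measurableSet_le measurable_const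
      ((measurable_avg _).comp (measurable_pi_lambda _ h.measurable_reward))
  have h1 : ∀ ω, (pullBound p (fun k => x k ω) v j : ENNReal) = (p.cumPulls 1 : ENNReal) +
      ∑ k ∈ Finset.Ico 1 (p.lastRound j), Set.indicator
        {ω | v ≤ avg (fun k => x k ω) (p.cumPulls k)}
        (fun _ => ((p.cumPulls (k + 1) - p.cumPulls k : ℕ) : ENNReal)) ω := by
    intro ω
    simp only [pullBound, Nat.cast_add, Nat.cast_sum, Set.indicator, Set.mem_ofPred_eq]
    congr 1
    exact Finset.sum_congr rfl fun k _ => by split_ifs <;> simp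
  simp_rw [h1]
  rw [lintegral_add_left measurable_const, lintegral_const, measure_univ, mul_one,
    lintegral_finsetSum _ fun k _ => measurable_const.indicator (hset k)]
  have hr0 : 0 ≤ 2 * Real.exp (-p.Λ) := by positivity
  have hr := p.exp_neg_Λ_le
  calc _ ≤ ENNReal.ofReal (33 * p.scale) + ∑ k ∈ Finset.Ico 1 (p.lastRound j),
        ENNReal.ofReal (17 * p.scale * (2 * Real.exp (-p.Λ)) ^ k) := by
        gcongr with k hk
        · rw [← ENNReal.ofReal_natCast]
          exact ENNReal.ofReal_le_ofReal p.cumPulls_one_le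
        · have hk1 := (Finset.mem_Ico.1 hk).1
          rw [lintegral_indicator_const (hset k), mul_pow, ← mul_assoc,
            ENNReal.ofReal_mul (by positivity), ← ENNReal.ofReal_natCast]
          gcongr
          · exact p.cumPulls_sub_le hk1
          · refine (measure_mono fun ω hω => ?_).trans ((h.measure_le_avg (p.cumPulls k)
              (t := p.ε / 8) (by have := p.ε_pos; positivity)).trans
              (ENNReal.ofReal_le_ofReal (p.exp_deviation_eighth_le hk1)))
            exact hv.trans hω
    _ = ENNReal.ofReal (33 * p.scale + ∑ k ∈ Finset.Ico 1 (p.lastRound j),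
          17 * p.scale * (2 * Real.exp (-p.Λ)) ^ k) := by
        rw [ENNReal.ofReal_add (by positivity) (Finset.sum_nonneg fun k _ => by positivity),
          ENNReal.ofReal_sum_of_nonneg fun k _ => by positivity]
    _ ≤ _ := by
        refine ENNReal.ofReal_le_ofReal ?_
        rw [← Finset.mul_sum]
        have h2 := sum_pow_Icc_le hr0 (by linarith) (p.lastRound j)
        have h3 : ∑ k ∈ Finset.Ico 1 (p.lastRound j), (2 * Real.exp (-p.Λ)) ^ k ≤
            ∑ k ∈ Finset.Icc 1 (p.lastRound j), (2 * Real.exp (-p.Λ)) ^ k :=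
          Finset.sum_le_sum_of_subset_of_nonneg Finset.Ico_subset_Icc_self fun k _ _ => by positivity
        nlinarith

lemma measurableSet_neverLow {x : ℕ → Ω → ℝ} (hx : ∀ k, Measurable (x k)) (p : Params) (μ : ℝ)
    (j : ℕ) : MeasurableSet {ω | NeverLow p μ (fun k => x k ω) j} := by
  unfold NeverLow
  simp only [Set.ofPred_forall]
  exact Finset.measurableSet_biInter _ fun k _ => measurableSet_lt measurable_const
    ((measurable_avg _).comp (measurable_pi_lambda _ hx))

lemma IsArm.le_measure_neverLow_inter (h : IsArm P μ x u) (p : Params) (j : ℕ) {a : ℝ}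
    (h1 : a ≤ 1) :
    ENNReal.ofReal (0.9 * a) ≤ P {ω | NeverLow p μ (fun k => x k ω) j ∧ u ω ≤ a} := by
  have h2 : MeasurableSet {z : ℕ → ℝ | NeverLow p μ z j} :=
    measurableSet_neverLow (x := fun k (z : ℕ → ℝ) => z k) (fun k => measurable_pi_apply k) p μ j
  have h3 := h.indepFun.measure_inter_preimage_eq_mul _ _ h2 (measurableSet_Iic (a := a))
  have h4 : {ω | NeverLow p μ (fun k => x k ω) j ∧ u ω ≤ a} =
    (fun ω k => x k ω) ⁻¹' {z : ℕ → ℝ | NeverLow p μ z j} ∩ u ⁻¹' Set.Iic a := rfl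
  have h5 : u ⁻¹' Set.Iic a = {ω | u ω ≤ a} := rfl
  rw [h4, h3, h5, h.measure_number_le h1, ENNReal.ofReal_mul (by norm_num)]
  gcongr
  have h6 := h.measure_not_neverLow_le p j
  have h7 := prob_add_prob_compl (μ := P) (measurableSet_neverLow h.measurable_reward p μ j)
  change ENNReal.ofReal 0.9 ≤ P {ω | NeverLow p μ (fun k => x k ω) j}
  have h8 : (1 : ENNReal) ≤ P {ω | NeverLow p μ (fun k => x k ω) j} + ENNReal.ofReal 0.1 := by
    rw [← h7]
    gcongr
    exact h6.trans (ENNReal.ofReal_le_ofReal (by linarith [p.exp_neg_Λ_le]))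
  rw [show (0.9 : ℝ) = 1 - 0.1 by norm_num, ENNReal.ofReal_sub _ (by norm_num),
    ENNReal.ofReal_one]
  exact tsub_le_iff_right.2 h8

lemma Params.threshold_le (p : Params) (j : ℕ) (v : ℝ) : p.threshold j v ≤ p.ε / 2 := by
  have := p.ε_pos
  unfold Params.threshold
  split_ifs <;> linarith

lemma Params.le_threshold (p : Params) (j : ℕ) (v : ℝ) : p.ε / 4 ≤ p.threshold j v := by
  have := p.ε_pos
  unfold Params.threshold
  split_ifs <;> linarith

lemma NeverLow.passes {p : Params} {μ : ℝ} {x : ℕ → ℝ} {j : ℕ} (h : NeverLow p μ x j) {v : ℝ}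
    (hv : v ≤ μ - p.ε / 8) : Passes p x v j := fun k hk => hv.trans (h k hk).le

end Arm

/-! ### Expected number of pulls -/

namespace Params

/-- Potential that pays for comparisons against a borderline stored arm. -/
def counterPotential (p : Params) (j : ℕ) : ℝ :=
  150 * p.scale * (Real.log j * (1 + Real.log j))

lemma counterPotential_nonneg (p : Params) (j : ℕ) : 0 ≤ p.counterPotential j := by
  have h1 := log_counter_nonneg j
  have h2 := p.four_le_scale
  unfold counterPotential
  positivity

lemma counterPotential_one (p : Params) : p.counterPotential 1 = 0 := by
  simp [counterPotential]

/-- From `log (j + 1) ≤ log j + 1 / j`, the product `log j * (1 + log j)` grows by at most `2 * log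
j / j + 1 / j + 1 / j ^ 2 ≤ 4`. -/
lemma counterPotential_succ_le (p : Params) {j : ℕ} (hj : 1 ≤ j) :
    p.counterPotential (j + 1) ≤ p.counterPotential j + 600 * p.scale := by
  have hj' : (1 : ℝ) ≤ j := by exact_mod_cast hj
  have h1 := log_counter_nonneg j
  have h2 := p.four_le_scale
  have h3 : Real.log ((j + 1 : ℕ) : ℝ) ≤ Real.log j + 1 / j := by
    have h4 : ((j + 1 : ℕ) : ℝ) = j * (1 + 1 / j) := by
      push_cast
      field_simp
    rw [h4, Real.log_mul (by positivity) (by positivity)]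
    have := Real.log_le_sub_one_of_pos (show (0 : ℝ) < 1 + 1 / j by positivity)
    linarith
  have h5 : Real.log j * (1 / j) ≤ 1 := by
    rw [mul_one_div, div_le_one (by positivity)]
    exact (Real.log_le_sub_one_of_pos (by positivity)).trans (by linarith)
  have h6 : (1 : ℝ) / j ≤ 1 := by rwa [div_le_one (by positivity)]
  have h7 : (0 : ℝ) ≤ 1 / j := by positivity
  have h8 := log_counter_nonneg (j + 1)
  unfold counterPotential
  rw [show 150 * p.scale * (Real.log j * (1 + Real.log j)) + 600 * p.scale
    = 150 * p.scale * (Real.log j * (1 + Real.log j) + 4) by ring]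
  gcongr
  calc Real.log ((j + 1 : ℕ) : ℝ) * (1 + Real.log ((j + 1 : ℕ) : ℝ))
      ≤ (Real.log j + 1 / j) * (1 + (Real.log j + 1 / j)) := by gcongr
    _ ≤ _ := by nlinarith

lemma counterPotential_le_succ (p : Params) {j : ℕ} (hj : 1 ≤ j) :
    p.counterPotential j ≤ p.counterPotential (j + 1) := by
  have hj' : (0 : ℝ) < j := by exact_mod_cast hj
  have h1 := log_counter_nonneg j
  have h2 := p.four_le_scale
  have h3 : Real.log j ≤ Real.log ((j + 1 : ℕ) : ℝ) := by
    gcongr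
    omega
  unfold counterPotential
  gcongr

end Params

/-- Number of pulls plus the potential of the counter. -/
def costPotential {n : ℕ} (p : Params) (s : Summary n) : ENNReal :=
  ENNReal.ofReal (s.2.2.2 + p.counterPotential s.2.2.1)

lemma measurable_costPotential {n : ℕ} (p : Params) :
    Measurable (costPotential p : Summary n → ENNReal) := by
  unfold costPotential
  refine ENNReal.measurable_ofReal.comp (Measurable.add ?_ ?_)
  · exact (measurable_from_top (f := fun k : ℕ => (k : ℝ))).comp (by fun_prop)
  · exact (measurable_from_top (f := p.counterPotential)).comp (by fun_prop)

lemma pullBound_le_scale (p : Params) (x : ℕ → ℝ) (v : ℝ) {j : ℕ} (hj : 1 ≤ j) :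
    (pullBound p x v j : ℝ) ≤ 130 * p.scale * (1 + Real.log j) :=
  le_trans (by exact_mod_cast pullBound_le p x v (p.one_le_lastRound (p.τ_nonneg hj)))
    (p.cumPulls_lastRound_le hj)

section Step

variable {n : ℕ} {Ω : Type*} [MeasurableSpace Ω] {P : Measure Ω} [IsProbabilityMeasure P]
  {μ : ℝ} {x : ℕ → Ω → ℝ} {u : Ω → ℝ}

/-- The budget `780` is `600` for the growth of the potential, `130` for the draw `α = ε / 4`, and
`50` for the draw `α = ε / 2`, whose level is at least `μ + ε / 8`. -/
lemma IsArm.lintegral_costPotential_le_of_not_better (h : IsArm P μ x u) (p : Params) (i : Fin n)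
    (s : Summary n) (hj : 1 ≤ s.2.2.1) (hμ : μ ≤ s.2.1 + 3 * p.ε / 8) :
    ∫⁻ ω, costPotential p (summaryStep p i s (fun k => x k ω, u ω)) ∂P ≤
      costPotential p s + ENNReal.ofReal (780 * p.scale) := by
  classical
  obtain ⟨b, m, j, N⟩ := s
  dsimp only at hj hμ
  have hR := p.four_le_scale
  have hlog := Params.log_counter_nonneg j
  have hΦ := p.counterPotential_nonneg j
  have hΦ1 := p.counterPotential_succ_le hj
  have hΦ2 := p.counterPotential_le_succ hj
  have hset : MeasurableSet {ω | u ω ≤ 1 / (Real.log j + 1)} :=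
    measurableSet_le h.measurable_number measurable_const
  have key : ∀ ω, costPotential p (summaryStep p i (b, m, j, N) (fun k => x k ω, u ω)) ≤
      ENNReal.ofReal (N + (p.counterPotential j + 600 * p.scale)) +
      (Set.indicator {ω | u ω ≤ 1 / (Real.log j + 1)}
        (fun _ => ENNReal.ofReal (130 * p.scale * (1 + Real.log j))) ω +
      (pullBound p (fun k => x k ω) (m + p.ε / 2) j : ENNReal)) := by
    intro ω
    have h1 : costPotential p (summaryStep p i (b, m, j, N) (fun k => x k ω, u ω)) ≤
        ENNReal.ofReal (N + (p.counterPotential j + 600 * p.scale)) +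
        (pullBound p (fun k => x k ω) (m + p.threshold j (u ω)) j : ENNReal) := by
      rw [← ENNReal.ofReal_natCast (pullBound _ _ _ _), ← ENNReal.ofReal_add (by positivity)
        (by positivity), costPotential]
      refine ENNReal.ofReal_le_ofReal ?_
      unfold summaryStep
      split_ifs
      · simp only [Nat.cast_add, p.counterPotential_one]
        linarith
      · simp only [Nat.cast_add]
        linarith
    refine h1.trans ?_
    gcongr
    by_cases hu : u ω ≤ 1 / (Real.log j + 1)
    · rw [Set.indicator_of_mem (by exact hu), ← ENNReal.ofReal_natCast]
      exact le_add_right (ENNReal.ofReal_le_ofReal (pullBound_le_scale p _ _ hj))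
    · rw [Params.threshold, if_neg hu]
      exact le_add_self
  refine (lintegral_mono key).trans ?_
  rw [lintegral_add_left measurable_const, lintegral_const, measure_univ, mul_one,
    lintegral_add_left (measurable_const.indicator hset), lintegral_indicator_const hset,
    h.measure_number_le (by rw [div_le_one (by positivity)]; linarith),
    ← ENNReal.ofReal_mul (by positivity)]
  -- The probability of the small threshold cancels the logarithm in the worst-case cost.
  have h2 : 130 * p.scale * (1 + Real.log j) * (1 / (Real.log j + 1)) = 130 * p.scale := by
    field_simp
    ring
  rw [h2]
  grw [h.lintegral_pullBound_le p (v := m + p.ε / 2) (by linarith) j]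
  rw [costPotential, ← ENNReal.ofReal_add (by positivity) (by positivity),
    ← ENNReal.ofReal_add (by positivity) (by positivity),
    ← ENNReal.ofReal_add (by positivity) (by positivity)]
  refine ENNReal.ofReal_le_ofReal ?_
  dsimp only
  linarith

/-- All rounds are charged. With `α = ε / 4` the level is at most `μ - ε / 8`, so a run of averages
that is never low is accepted and wipes out the potential. -/
lemma IsArm.lintegral_costPotential_le_of_better (h : IsArm P μ x u) (p : Params) (i : Fin n)
    (s : Summary n) (hj : 1 ≤ s.2.2.1) (hμ : s.2.1 + 3 * p.ε / 8 ≤ μ) :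
    ∫⁻ ω, costPotential p (summaryStep p i s (fun k => x k ω, u ω)) ∂P ≤
      costPotential p s + ENNReal.ofReal (780 * p.scale) := by
  classical
  obtain ⟨b, m, j, N⟩ := s
  dsimp only at hj hμ
  have hR := p.four_le_scale
  have hlog := Params.log_counter_nonneg j
  have hΦ := p.counterPotential_nonneg j
  have hΦ' := p.counterPotential_nonneg (j + 1)
  have hΦ1 := p.counterPotential_succ_le hj
  have hΦ2 := p.counterPotential_le_succ hj
  set a : ℝ := 1 / (Real.log j + 1) with ha
  have ha0 : 0 ≤ a := by positivity
  have ha1 : a ≤ 1 := by rw [ha, div_le_one (by positivity)]; linarith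
  have hset : MeasurableSet {ω | NeverLow p μ (fun k => x k ω) j ∧ u ω ≤ a} :=
    (measurableSet_neverLow h.measurable_reward p μ j).inter
      (measurableSet_le h.measurable_number measurable_const)
  have hcompl : P {ω | NeverLow p μ (fun k => x k ω) j ∧ u ω ≤ a}ᶜ ≤
      ENNReal.ofReal (1 - 0.9 * a) := by
    rw [prob_compl_eq_one_sub hset, ENNReal.ofReal_sub _ (by positivity), ENNReal.ofReal_one]
    exact tsub_le_tsub_left (h.le_measure_neverLow_inter p j ha1) 1
  have key : ∀ ω, costPotential p (summaryStep p i (b, m, j, N) (fun k => x k ω, u ω)) ≤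
      ENNReal.ofReal (N + 130 * p.scale * (1 + Real.log j)) +
      Set.indicator {ω | NeverLow p μ (fun k => x k ω) j ∧ u ω ≤ a}ᶜ
        (fun _ => ENNReal.ofReal (p.counterPotential (j + 1))) ω := by
    intro ω
    have h1 := pullBound_le_scale p (fun k => x k ω) (m + p.threshold j (u ω)) hj
    by_cases hP : Passes p (fun k => x k ω) (m + p.threshold j (u ω)) j
    · refine le_add_right ?_
      rw [summaryStep, if_pos hP, costPotential]
      refine ENNReal.ofReal_le_ofReal ?_
      simp only [Nat.cast_add, p.counterPotential_one]
      linarith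
    · have hmem : ω ∈ {ω | NeverLow p μ (fun k => x k ω) j ∧ u ω ≤ a}ᶜ := by
        rintro ⟨h2, h3⟩
        refine hP (h2.passes ?_)
        rw [Params.threshold, if_pos h3]
        linarith
      rw [Set.indicator_of_mem hmem, ← ENNReal.ofReal_add (by positivity) (by positivity),
        summaryStep, if_neg hP, costPotential]
      refine ENNReal.ofReal_le_ofReal ?_
      simp only [Nat.cast_add]
      linarith
  refine (lintegral_mono key).trans ?_
  rw [lintegral_add_left measurable_const, lintegral_const, measure_univ, mul_one,
    lintegral_indicator_const hset.compl]
  grw [hcompl]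
  rw [← ENNReal.ofReal_mul (by positivity), costPotential,
    ← ENNReal.ofReal_add (by positivity) (mul_nonneg (by positivity) (by linarith)),
    ← ENNReal.ofReal_add (by positivity) (by positivity)]
  refine ENNReal.ofReal_le_ofReal ?_
  dsimp only
  -- The expected saving is at least `0.9 * 150 = 135` times `scale * log j`, more than the
  -- logarithmic part `130 * scale * log j` of the cost.
  have h4 : p.counterPotential j * a = 150 * p.scale * Real.log j := by
    rw [ha, Params.counterPotential]
    field_simp
    ring
  have h5 := mul_le_mul_of_nonneg_right hΦ2 ha0
  rw [h4] at h5
  have h6 : 0 ≤ p.scale * Real.log j := by positivity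
  linarith

lemma IsArm.lintegral_costPotential_le (h : IsArm P μ x u) (p : Params) (i : Fin n)
    (s : Summary n) (hj : 1 ≤ s.2.2.1) :
    ∫⁻ ω, costPotential p (summaryStep p i s (fun k => x k ω, u ω)) ∂P ≤
      costPotential p s + ENNReal.ofReal (780 * p.scale) := by
  rcases le_total μ (s.2.1 + 3 * p.ε / 8) with hμ | hμ
  · exact h.lintegral_costPotential_le_of_not_better p i s hj hμ
  · exact h.lintegral_costPotential_le_of_better p i s hj hμ

end Step

lemma finRange_nodup_cons (n : ℕ) [NeZero n] : ((0 : Fin n) :: (List.finRange n).tail).Nodup := by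
  rw [zero_cons_finRange_tail]
  exact List.nodup_finRange n

lemma IsStream.lintegral_log_length_le {n : ℕ} [NeZero n] {Ω : Type*} [MeasurableSpace Ω]
    {P : Measure Ω} [IsProbabilityMeasure P] {ν : Fin n → Measure ℝ} {X : Fin n → ℕ → Ω → ℝ}
    {U : Fin n → Ω → ℝ} (h : IsStream P ν X U) (p : Params) :
    ∫⁻ ω, ((run p (fun i k => X i k ω) (fun i => U i ω)).log.length : ENNReal) ∂P ≤
      ENNReal.ofReal (780 * n * p.scale) := by
  have hR := p.four_le_scale
  calc _ ≤ ∫⁻ ω, costPotential p (summaryRun p (fun i k => X i k ω) (fun i => U i ω)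
            (List.finRange n).tail) ∂P := by
        refine lintegral_mono fun ω => ?_
        rw [← ENNReal.ofReal_natCast]
        refine ENNReal.ofReal_le_ofReal ?_
        have h1 := (run_spec p (fun i k => X i k ω) (fun i => U i ω)).1.2.2.2
        exact le_add_of_le_of_nonneg (by exact_mod_cast h1) (p.counterPotential_nonneg _)
    _ ≤ _ := h.lintegral_summaryRun_le p (measurable_costPotential p) _
        (fun i s hj => (h.isArm i).lintegral_costPotential_le p i s hj) _ (finRange_nodup_cons n)
    _ = ENNReal.ofReal (p.cumPulls 1 + (n - 1 : ℕ) * (780 * p.scale)) := by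
        simp only [costPotential, summaryInit, p.counterPotential_one, add_zero, lintegral_const,
          measure_univ, mul_one, List.length_tail, List.length_finRange]
        rw [ENNReal.ofReal_add (by positivity) (by positivity),
          ENNReal.ofReal_mul (p := ((n - 1 : ℕ) : ℝ)) (by positivity),
          ENNReal.ofReal_natCast (n - 1)]
    _ ≤ _ := by
        refine ENNReal.ofReal_le_ofReal ?_
        rw [Nat.cast_sub (Nat.one_le_iff_ne_zero.2 (NeZero.ne n))]
        push_cast
        have := p.cumPulls_one_le
        linarith

/-! ### A bounded potential that decreases at every step -/

section Potential

/-- Potential of a stored arm whose estimate is `d` units below a fixed level. -/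
def levelPotential (Λ d : ℝ) (j : ℕ) : ℝ :=
  if 0 < d then 3 - Real.exp (-(Λ * d)) * (1 - 1 / (2 * j))
  else Real.exp (Λ * d) * (1 + 1 / (2 * j))

variable {Λ d d' : ℝ} {j : ℕ}

lemma one_div_two_mul_counter_le (hj : 1 ≤ j) : (1 : ℝ) / (2 * j) ≤ 1 / 2 := by
  have : (1 : ℝ) ≤ j := by exact_mod_cast hj
  gcongr
  linarith

lemma levelPotential_nonneg (hΛ : 0 ≤ Λ) (hj : 1 ≤ j) : 0 ≤ levelPotential Λ d j := by
  have h1 := one_div_two_mul_counter_le hj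
  have h2 : (0 : ℝ) ≤ 1 / (2 * j) := by positivity
  unfold levelPotential
  split_ifs with h
  · have h3 : Real.exp (-(Λ * d)) ≤ 1 := Real.exp_le_one_iff.2 (by nlinarith)
    have h4 := Real.exp_pos (-(Λ * d))
    nlinarith
  · positivity

lemma levelPotential_le_of_nonpos (hΛ : 0 ≤ Λ) (hj : 1 ≤ j) (hd : d ≤ 0) :
    levelPotential Λ d j ≤ 3 / 2 := by
  have h1 := one_div_two_mul_counter_le hj
  have h2 : (0 : ℝ) ≤ 1 / (2 * j) := by positivity
  rw [levelPotential, if_neg hd.not_gt]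
  have h3 : Real.exp (Λ * d) ≤ 1 := Real.exp_le_one_iff.2 (by nlinarith)
  have h4 := Real.exp_pos (Λ * d)
  nlinarith

lemma levelPotential_le (hΛ : 0 ≤ Λ) (hj : 1 ≤ j) : levelPotential Λ d j ≤ 3 := by
  rcases le_or_gt d 0 with h | h
  · exact (levelPotential_le_of_nonpos hΛ hj h).trans (by norm_num)
  · have h1 := one_div_two_mul_counter_le hj
    rw [levelPotential, if_pos h]
    have h4 := Real.exp_pos (-(Λ * d))
    nlinarith

/-- Only the factor `1 ± 1 / (2 * j)` changes; its increment `1 / (2 * j * (j + 1))` is at least `1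
/ (4 * j ^ 2)`. -/
lemma levelPotential_reject (hj : 1 ≤ j) :
    levelPotential Λ d (j + 1) ≤
      levelPotential Λ d j - Real.exp (-(Λ * |d|)) * (1 / (4 * (j : ℝ) ^ 2)) := by
  have hj' : (1 : ℝ) ≤ j := by exact_mod_cast hj
  have h1 : (1 : ℝ) / (4 * (j : ℝ) ^ 2) ≤ 1 / (2 * j) - 1 / (2 * ((j + 1 : ℕ) : ℝ)) := by
    push_cast
    rw [div_sub_div _ _ (by positivity) (by positivity), div_le_div_iff₀ (by positivity)
      (by positivity)]
    nlinarith
  unfold levelPotential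
  split_ifs with h
  · rw [abs_of_pos h]
    nlinarith [Real.exp_pos (-(Λ * d))]
  · rw [abs_of_nonpos (not_lt.1 h), mul_neg, neg_neg]
    nlinarith [Real.exp_pos (Λ * d)]

lemma two_le_exp_div_four (hΛ : 4 ≤ Λ) : 2 ≤ Real.exp (Λ / 4) := by
  have := Real.add_one_le_exp (Λ / 4)
  linarith

/-- Resetting `j` to `1` undoes the gain in `1 ± 1 / (2 * j)`, but moving `d` by `1 / 4` changes the
exponential by a factor `exp (Λ / 4) ≥ 2`, which outweighs it. Crossing zero uses the gap between
values at most `3 / 2` and values at least `2`. -/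
lemma levelPotential_accept (hΛ : 4 ≤ Λ) (hj : 1 ≤ j) (hd : d' ≤ d - 1 / 4) :
    levelPotential Λ d' 1 ≤
      levelPotential Λ d j - Real.exp (-(Λ * |d|)) * (1 / (4 * (j : ℝ) ^ 2)) := by
  have hj' : (1 : ℝ) ≤ j := by exact_mod_cast hj
  have h1 := one_div_two_mul_counter_le hj
  have h2 : (0 : ℝ) ≤ 1 / (2 * j) := by positivity
  have h3 : (1 : ℝ) / (4 * (j : ℝ) ^ 2) ≤ 1 / 4 := by
    gcongr
    nlinarith
  have h4 : (1 : ℝ) / (4 * (j : ℝ) ^ 2) ≤ 1 / (2 * j) :=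
    one_div_le_one_div_of_le (by positivity) (by nlinarith)
  have h6 := two_le_exp_div_four hΛ
  have h0 : (0 : ℝ) ≤ 1 / (4 * (j : ℝ) ^ 2) := by positivity
  rcases le_or_gt d 0 with h | h
  · rw [levelPotential, levelPotential, if_neg (by linarith), if_neg h.not_gt, abs_of_nonpos h,
      mul_neg, neg_neg]
    have h7 : Real.exp (Λ * d') * Real.exp (Λ / 4) ≤ Real.exp (Λ * d) := by
      rw [← Real.exp_add]
      exact Real.exp_le_exp.2 (by nlinarith)
    have h8 := Real.exp_pos (Λ * d')
    have h9 := Real.exp_pos (Λ * d)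
    push_cast
    nlinarith
  · have h9 := Real.exp_pos (-(Λ * d))
    have h10 : Real.exp (-(Λ * d)) ≤ 1 := Real.exp_le_one_iff.2 (by nlinarith)
    rcases le_or_gt d' 0 with h' | h'
    · have h5 := levelPotential_le_of_nonpos (by linarith : 0 ≤ Λ) le_rfl h'
      refine h5.trans ?_
      rw [levelPotential, if_pos h, abs_of_pos h]
      nlinarith
    · rw [levelPotential, levelPotential, if_pos h, if_pos h', abs_of_pos h]
      have h7 : Real.exp (-(Λ * d)) * Real.exp (Λ / 4) ≤ Real.exp (-(Λ * d')) := by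
        rw [← Real.exp_add]
        exact Real.exp_le_exp.2 (by nlinarith)
      push_cast
      nlinarith

/-- With `e = exp (-(Λ * (x + 1 / 8)))`, moving `d` by at least `1 / 2` takes the potential from at
least `3 - e / 5` to at most `3 - e / 2`; this is the source of `0.3`. -/
lemma levelPotential_accept_far (hΛ : 4 ≤ Λ) (hj : 1 ≤ j) {x : ℝ} (hx : 0 ≤ x) (hd : x + 5 / 8 ≤ d)
    (hd' : d' ≤ x + 1 / 8) :
    levelPotential Λ d' 1 ≤ levelPotential Λ d j - 0.3 * Real.exp (-(Λ * (x + 1 / 8))) := by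
  have h1 := one_div_two_mul_counter_le hj
  have h2 : (0 : ℝ) ≤ 1 / (2 * j) := by positivity
  have h3 := Real.exp_pos (-(Λ * (x + 1 / 8)))
  have h4 : 5 * Real.exp (-(Λ * d)) ≤ Real.exp (-(Λ * (x + 1 / 8))) := by
    have h5 : 5 ≤ Real.exp (Λ / 2) := by
      have h6 := Real.quadratic_le_exp_of_nonneg (by linarith : 0 ≤ Λ / 2)
      nlinarith
    calc 5 * Real.exp (-(Λ * d)) ≤ Real.exp (Λ / 2) * Real.exp (-(Λ * d)) := by gcongr
      _ ≤ _ := by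
        rw [← Real.exp_add]
        exact Real.exp_le_exp.2 (by nlinarith)
  have h7 : Real.exp (-(Λ * (x + 1 / 8))) ≤ 1 := Real.exp_le_one_iff.2 (by nlinarith)
  have h8 := Real.exp_pos (-(Λ * d))
  have h9 : 3 - Real.exp (-(Λ * d)) ≤ levelPotential Λ d j := by
    rw [levelPotential, if_pos (by linarith)]
    nlinarith
  rcases le_or_gt d' 0 with h' | h'
  · have h5 := levelPotential_le_of_nonpos (by linarith : 0 ≤ Λ) le_rfl h'
    linarith
  · have h10 : Real.exp (-(Λ * (x + 1 / 8))) ≤ Real.exp (-(Λ * d')) :=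
      Real.exp_le_exp.2 (by nlinarith)
    have h11 : levelPotential Λ d' 1 = 3 - Real.exp (-(Λ * d')) * (1 / 2) := by
      rw [levelPotential, if_pos h']
      norm_num
    linarith

/-- Of the exponent `64 * t ^ 2 * Λ`, the part `8 * Λ` gives the weight and `Λ * e` the distance
factor. The term in `log j` gives the factor `1 / j ^ 2`, matching the drop of the potential. -/
lemma exp_deviation_le_of_le (hΛ : 4 ≤ Λ) (hj : 1 ≤ j) {t e : ℝ} (he : 0 ≤ e)
    (ht : e + 8 ≤ 64 * t ^ 2) :
    Real.exp (-(64 * t ^ 2 * (Λ + 2 * Real.log j))) ≤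
      4 * Real.exp (-(8 * Λ)) * (Real.exp (-(Λ * e)) * (1 / (4 * (j : ℝ) ^ 2))) := by
  have hj' : (0 : ℝ) < j := by exact_mod_cast hj
  have h1 : (1 : ℝ) / (4 * (j : ℝ) ^ 2) = 1 / 4 * Real.exp (-(2 * Real.log j)) := by
    rw [Real.exp_neg, two_mul, Real.exp_add, Real.exp_log hj']
    field_simp
  have h2 := Params.log_counter_nonneg j
  rw [h1, show 4 * Real.exp (-(8 * Λ)) * (Real.exp (-(Λ * e)) *
    (1 / 4 * Real.exp (-(2 * Real.log j)))) =
    Real.exp (-(8 * Λ)) * Real.exp (-(Λ * e)) * Real.exp (-(2 * Real.log j)) by ring,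
    ← Real.exp_add, ← Real.exp_add]
  refine Real.exp_le_exp.2 ?_
  nlinarith

end Potential

/-! ### One-step bounds for the risk of a wrong answer -/

lemma summaryStep_passes {n : ℕ} {p : Params} {i : Fin n} {s : Summary n} {ξ : (ℕ → ℝ) × ℝ}
    (h : Passes p ξ.1 (s.2.1 + p.threshold s.2.2.1 ξ.2) s.2.2.1) :
    (summaryStep p i s ξ).1 = i ∧
      (summaryStep p i s ξ).2.1 = avg ξ.1 (p.cumPulls (p.lastRound s.2.2.1)) ∧
      (summaryStep p i s ξ).2.2.1 = 1 := by
  rw [summaryStep, if_pos h]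
  exact ⟨rfl, rfl, rfl⟩

lemma summaryStep_not_passes {n : ℕ} {p : Params} {i : Fin n} {s : Summary n} {ξ : (ℕ → ℝ) × ℝ}
    (h : ¬ Passes p ξ.1 (s.2.1 + p.threshold s.2.2.1 ξ.2) s.2.2.1) :
    (summaryStep p i s ξ).1 = s.1 ∧ (summaryStep p i s ξ).2.1 = s.2.1 ∧
      (summaryStep p i s ξ).2.2.1 = s.2.2.1 + 1 := by
  rw [summaryStep, if_neg h]
  exact ⟨rfl, rfl, rfl⟩

lemma Params.lastRound_mem (p : Params) {j : ℕ} (hj : 1 ≤ j) :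
    p.lastRound j ∈ Finset.Icc 1 (p.lastRound j) :=
  Finset.mem_Icc.2 ⟨p.one_le_lastRound (p.τ_nonneg hj), le_rfl⟩

lemma Passes.le_estimate {p : Params} {x : ℕ → ℝ} {m v : ℝ} {j : ℕ}
    (h : Passes p x (m + p.threshold j v) j) (hj : 1 ≤ j) :
    m + p.ε / 4 ≤ avg x (p.cumPulls (p.lastRound j)) := by
  have h1 := h _ (p.lastRound_mem hj)
  linarith [p.le_threshold j v]

lemma le_summaryStep_estimate {n : ℕ} (p : Params) (i : Fin n) (s : Summary n) (ξ : (ℕ → ℝ) × ℝ)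
    (hj : 1 ≤ s.2.2.1) : s.2.1 ≤ (summaryStep p i s ξ).2.1 := by
  by_cases h : Passes p ξ.1 (s.2.1 + p.threshold s.2.2.1 ξ.2) s.2.2.1
  · rw [(summaryStep_passes h).2.1]
    linarith [h.le_estimate hj, p.ε_pos]
  · rw [(summaryStep_not_passes h).2.1]

/-- The potential of the stored estimate relative to the level `θ`. -/
def summaryPotential {n : ℕ} (p : Params) (θ : ℝ) (s : Summary n) : ℝ :=
  levelPotential p.Λ ((θ - s.2.1) / p.ε) s.2.2.1

/-- This holds for every outcome, since any acceptance raises the estimate by at least `ε / 4`. -/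
lemma summaryPotential_step_le {n : ℕ} (p : Params) (θ : ℝ) (i : Fin n) (s : Summary n)
    (ξ : (ℕ → ℝ) × ℝ) (hj : 1 ≤ s.2.2.1) :
    summaryPotential p θ (summaryStep p i s ξ) ≤ summaryPotential p θ s -
      Real.exp (-(p.Λ * |(θ - s.2.1) / p.ε|)) * (1 / (4 * (s.2.2.1 : ℝ) ^ 2)) := by
  have hε := p.ε_pos
  unfold summaryPotential
  by_cases h : Passes p ξ.1 (s.2.1 + p.threshold s.2.2.1 ξ.2) s.2.2.1
  · obtain ⟨-, h2, h3⟩ := summaryStep_passes (i := i) h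
    rw [h2, h3]
    refine levelPotential_accept p.four_le_Λ hj ?_
    have := h.le_estimate hj
    rw [div_le_iff₀ hε, sub_mul, div_mul_cancel₀ _ hε.ne']
    linarith
  · obtain ⟨-, h2, h3⟩ := summaryStep_not_passes (i := i) h
    rw [h2, h3]
    exact levelPotential_reject hj

lemma summaryPotential_nonneg {n : ℕ} (p : Params) (θ : ℝ) (s : Summary n) (hj : 1 ≤ s.2.2.1) :
    0 ≤ summaryPotential p θ s := levelPotential_nonneg (by linarith [p.four_le_Λ]) hj

open Classical in
/-- Indicator of storing an arm of `bad` with an estimate that is at least `θ`. -/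
def overrated {n : ℕ} (bad : Set (Fin n)) (θ : ℝ) (s : Summary n) : ℝ :=
  if s.1 ∈ bad ∧ θ ≤ s.2.1 then 1 else 0

lemma overrated_nonneg {n : ℕ} (bad : Set (Fin n)) (θ : ℝ) (s : Summary n) :
    0 ≤ overrated bad θ s := by
  unfold overrated
  split_ifs <;> norm_num

lemma overrated_le_one {n : ℕ} (bad : Set (Fin n)) (θ : ℝ) (s : Summary n) :
    overrated bad θ s ≤ 1 := by
  unfold overrated
  split_ifs <;> norm_num

/-- The weight of `summaryPotential` in `riskPotential`. -/
def Params.riskWeight (p : Params) : ℝ := 4 * Real.exp (-(8 * p.Λ))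

lemma Params.riskWeight_pos (p : Params) : 0 < p.riskWeight := by
  unfold riskWeight
  positivity

/-- A supermartingale that bounds the probability of ending with an overrated arm. -/
def riskPotential {n : ℕ} (p : Params) (bad : Set (Fin n)) (θ : ℝ) (s : Summary n) : ENNReal :=
  ENNReal.ofReal (overrated bad θ s + p.riskWeight * summaryPotential p θ s)

lemma measurable_riskPotential {n : ℕ} (p : Params) (bad : Set (Fin n)) (θ : ℝ) :
    Measurable (riskPotential p bad θ) := by
  classical
  refine ENNReal.measurable_ofReal.comp (Measurable.add ?_ (Measurable.const_mul ?_ _))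
  · refine Measurable.ite (MeasurableSet.inter ?_ ?_) measurable_const measurable_const
    · exact measurable_fst (MeasurableSet.of_discrete (s := bad))
    · exact measurableSet_le (f := fun _ => θ) (g := fun s : Summary n => s.2.1)
        measurable_const (by fun_prop)
  · unfold summaryPotential
    refine measurable_nat_index (g := fun s : Summary n => s.2.2.1)
      (f := fun j s => levelPotential p.Λ ((θ - s.2.1) / p.ε) j) (by fun_prop) fun j => ?_
    unfold levelPotential
    refine Measurable.ite (measurableSet_lt measurable_const ?_) ?_ ?_ <;> fun_prop

section Step

variable {n : ℕ} {Ω : Type*} [MeasurableSpace Ω] {P : Measure Ω} [IsProbabilityMeasure P]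
  {μ : ℝ} {x : ℕ → Ω → ℝ} {u : Ω → ℝ}

lemma riskPotential_step_le_of_notMem (p : Params) {bad : Set (Fin n)} (θ : ℝ) {i : Fin n}
    (hi : i ∉ bad) (s : Summary n) (hj : 1 ≤ s.2.2.1) (ξ : (ℕ → ℝ) × ℝ) :
    riskPotential p bad θ (summaryStep p i s ξ) ≤ riskPotential p bad θ s := by
  have h1 := summaryPotential_step_le p θ i s ξ hj
  have h2 : 0 ≤ Real.exp (-(p.Λ * |(θ - s.2.1) / p.ε|)) * (1 / (4 * (s.2.2.1 : ℝ) ^ 2)) := by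
    positivity
  have h3 := p.riskWeight_pos
  refine ENNReal.ofReal_le_ofReal (add_le_add ?_ (by gcongr; linarith))
  by_cases h : Passes p ξ.1 (s.2.1 + p.threshold s.2.2.1 ξ.2) s.2.2.1
  · have h4 : overrated bad θ (summaryStep p i s ξ) = 0 := by
      rw [overrated, (summaryStep_passes h).1, if_neg fun h => hi h.1]
    rw [h4]
    exact overrated_nonneg _ _ _
  · rw [overrated, overrated, (summaryStep_not_passes h).1, (summaryStep_not_passes h).2.1]

/-- One step with a bad arm: a gain `γ` of the potential on the event `E` pays for accepting an
estimate with deviation `t`. -/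
lemma IsArm.lintegral_riskPotential_le_of_gain (h : IsArm P μ x u) (p : Params)
    (bad : Set (Fin n)) (θ : ℝ) (i : Fin n) (s : Summary n) (hj : 1 ≤ s.2.2.1)
    {E : Set Ω} (hE : MeasurableSet E) {η γ t : ℝ} (hη : 0 ≤ η) (hγ : 0 ≤ γ) (ht : 0 ≤ t)
    (hPE : P Eᶜ ≤ ENNReal.ofReal η) (hγs : γ ≤ summaryPotential p θ s)
    (hgain : ∀ ω ∈ E, summaryPotential p θ (summaryStep p i s (fun k => x k ω, u ω)) ≤
      summaryPotential p θ s - γ)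
    (hdev : ∀ y, θ ≤ y → s.2.1 + p.ε / 4 ≤ y → μ + t * p.ε ≤ y)
    (hpay : Real.exp (-(64 * t ^ 2 * (p.Λ + 2 * Real.log s.2.2.1))) + p.riskWeight * γ * η ≤
      p.riskWeight * γ) :
    ∫⁻ ω, riskPotential p bad θ (summaryStep p i s (fun k => x k ω, u ω)) ∂P ≤
      riskPotential p bad θ s := by
  have hB := p.riskWeight_pos
  have hε := p.ε_pos
  have ho := overrated_nonneg bad θ s
  set A : Set Ω := {ω | μ + t * p.ε ≤ avg (fun k => x k ω) (p.cumPulls (p.lastRound s.2.2.1))}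
    with hA
  have hAm : MeasurableSet A := measurableSet_le measurable_const
    ((measurable_avg _).comp (measurable_pi_lambda _ h.measurable_reward))
  have hPA : P A ≤ ENNReal.ofReal (Real.exp (-(64 * t ^ 2 * (p.Λ + 2 * Real.log s.2.2.1)))) :=
    (h.measure_le_avg _ (by positivity)).trans
      (ENNReal.ofReal_le_ofReal (p.exp_deviation_lastRound_le hj t))
  have hc : 0 ≤ overrated bad θ s + p.riskWeight * (summaryPotential p θ s - γ) :=
    add_nonneg ho (mul_nonneg hB.le (by linarith))
  have key : ∀ ω, riskPotential p bad θ (summaryStep p i s (fun k => x k ω, u ω)) ≤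
      ENNReal.ofReal (overrated bad θ s + p.riskWeight * (summaryPotential p θ s - γ)) +
      (A.indicator (fun _ => 1) ω + Eᶜ.indicator
        (fun _ => ENNReal.ofReal (p.riskWeight * γ)) ω) := by
    intro ω
    have h1 : ENNReal.ofReal (overrated bad θ (summaryStep p i s (fun k => x k ω, u ω))) ≤
        ENNReal.ofReal (overrated bad θ s) + A.indicator (fun _ => 1) ω := by
      by_cases hP : Passes p (fun k => x k ω) (s.2.1 + p.threshold s.2.2.1 (u ω)) s.2.2.1
      · by_cases hθ : θ ≤ avg (fun k => x k ω) (p.cumPulls (p.lastRound s.2.2.1))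
        · have hω : ω ∈ A := hdev _ hθ (hP.le_estimate hj)
          rw [Set.indicator_of_mem hω]
          refine le_add_left ?_
          rw [← ENNReal.ofReal_one]
          exact ENNReal.ofReal_le_ofReal (overrated_le_one _ _ _)
        · have h2 := (summaryStep_passes (i := i) (s := s) (ξ := (fun k => x k ω, u ω)) hP).2.1
          rw [overrated, h2, if_neg fun h => hθ h.2, ENNReal.ofReal_zero]
          exact zero_le
      · have h2 := summaryStep_not_passes (i := i) (s := s) (ξ := (fun k => x k ω, u ω)) hP
        rw [overrated, h2.1, h2.2.1]
        exact le_self_add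
    have h2 : ENNReal.ofReal (p.riskWeight *
        summaryPotential p θ (summaryStep p i s (fun k => x k ω, u ω))) ≤
        ENNReal.ofReal (p.riskWeight * (summaryPotential p θ s - γ)) +
        Eᶜ.indicator (fun _ => ENNReal.ofReal (p.riskWeight * γ)) ω := by
      by_cases hω : ω ∈ E
      · refine le_add_right (ENNReal.ofReal_le_ofReal ?_)
        gcongr
        exact hgain ω hω
      · rw [Set.indicator_of_mem (by exact hω), ← ENNReal.ofReal_add
          (mul_nonneg hB.le (by linarith)) (by positivity), ← mul_add, sub_add_cancel]
        refine ENNReal.ofReal_le_ofReal ?_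
        have h3 := summaryPotential_step_le p θ i s (fun k => x k ω, u ω) hj
        have h4 : 0 ≤ Real.exp (-(p.Λ * |(θ - s.2.1) / p.ε|)) *
          (1 / (4 * (s.2.2.1 : ℝ) ^ 2)) := by positivity
        gcongr
        linarith
    rw [riskPotential]
    refine ENNReal.ofReal_add_le.trans ((add_le_add h1 h2).trans (le_of_eq ?_))
    rw [ENNReal.ofReal_add ho (mul_nonneg hB.le (by linarith))]
    ring
  refine (lintegral_mono key).trans ?_
  rw [lintegral_add_left measurable_const, lintegral_const, measure_univ, mul_one,
    lintegral_add_left (measurable_const.indicator hAm), lintegral_indicator_const hAm,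
    lintegral_indicator_const hE.compl, one_mul]
  grw [hPA, hPE]
  rw [← ENNReal.ofReal_mul (by positivity), ← ENNReal.ofReal_add (by positivity) (by positivity),
    ← ENNReal.ofReal_add hc (by positivity), riskPotential]
  refine ENNReal.ofReal_le_ofReal ?_
  linarith

lemma IsArm.lintegral_riskPotential_le (h : IsArm P μ x u) (p : Params) (bad : Set (Fin n))
    (θ : ℝ) (i : Fin n) (hi : i ∈ bad → μ + 3 / 8 * p.ε ≤ θ) (s : Summary n)
    (hj : 1 ≤ s.2.2.1) :
    ∫⁻ ω, riskPotential p bad θ (summaryStep p i s (fun k => x k ω, u ω)) ∂P ≤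
      riskPotential p bad θ s := by
  by_cases hbad : i ∈ bad
  swap
  · calc _ ≤ ∫⁻ _, riskPotential p bad θ s ∂P :=
          lintegral_mono fun ω => riskPotential_step_le_of_notMem p θ hbad s hj _
      _ = _ := by rw [lintegral_const, measure_univ, mul_one]
  have hΛ := p.four_le_Λ
  have hε := p.ε_pos
  have hj' : (1 : ℝ) ≤ s.2.2.1 := by exact_mod_cast hj
  have hlog := Params.log_counter_nonneg s.2.2.1
  obtain ⟨y, hy⟩ : ∃ y, θ = μ + y * p.ε := ⟨(θ - μ) / p.ε, by field_simp; ring⟩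
  obtain ⟨d, hd⟩ : ∃ d, s.2.1 = θ - d * p.ε := ⟨(θ - s.2.1) / p.ε, by field_simp; ring⟩
  have hds : (θ - s.2.1) / p.ε = d := by rw [hd]; field_simp; ring
  have hy3 : 3 / 8 ≤ y := by
    have := hi hbad
    rw [hy] at this
    exact le_of_mul_le_mul_right (by linarith) hε
  -- The unconditional drop pays here, so the gain event is everything and `η = 0`.
  have near : ∀ t, 0 ≤ t → |d| + 8 ≤ 64 * t ^ 2 →
      (∀ z, θ ≤ z → s.2.1 + p.ε / 4 ≤ z → μ + t * p.ε ≤ z) →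
      ∫⁻ ω, riskPotential p bad θ (summaryStep p i s (fun k => x k ω, u ω)) ∂P ≤
        riskPotential p bad θ s := by
    intro t ht ht2 hdev
    have hgain := fun ξ => summaryPotential_step_le p θ i s ξ hj
    rw [hds] at hgain
    refine h.lintegral_riskPotential_le_of_gain p bad θ i s hj MeasurableSet.univ (η := 0)
      (γ := Real.exp (-(p.Λ * |d|)) * (1 / (4 * (s.2.2.1 : ℝ) ^ 2))) le_rfl (by positivity) ht
      (by simp) ?_ (fun ω _ => hgain _) hdev ?_
    -- Any outcome serves: the potential stays nonnegative after dropping by `γ`, so it was at least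
    -- `γ`.
    · have h1 := hgain (fun _ => 0, 0)
      have h2 := summaryPotential_nonneg p θ (summaryStep p i s (fun _ => 0, 0))
        (summaryStep_counter p i s _)
      linarith
    · rw [mul_zero, add_zero]
      exact exp_deviation_le_of_le hΛ hj (abs_nonneg d) ht2
  rcases le_or_gt d 0 with hd0 | hd0
  -- The stored estimate is already at least `θ`; acceptance must exceed it by `ε / 4`, hence a
  -- deviation of `y - d + 1 / 4`.
  · refine near (y - d + 1 / 4) (by linarith) ?_ fun z h1 h2 => ?_
    · rw [abs_of_nonpos hd0]
      nlinarith
    · rw [hd, hy] at h2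
      linarith
  -- At the boundary `d = y + 5 / 8` one has `m + ε / 2 = μ - ε / 8`. Up to there `d + 8 ≤ 64 * y ^
  -- 2`, with equality at `y = 3 / 8`, `d = 1`.
  rcases le_or_gt d (y + 5 / 8) with hdy | hdy
  · refine near y (by linarith) ?_ fun z h1 h2 => ?_
    · rw [abs_of_pos hd0]
      nlinarith
    · rwa [← hy]
  -- The stored estimate is so low that, unless an average is low, the arm passes even with `α = ε /
  -- 2` and its estimate exceeds `μ - ε / 8`. The payment closes because `4 * 0.3 * 0.9 > 1`.
  · have hr := p.exp_neg_Λ_le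
    refine h.lintegral_riskPotential_le_of_gain p bad θ i s hj
      (measurableSet_neverLow h.measurable_reward p μ s.2.2.1) (η := 0.1)
      (γ := 0.3 * Real.exp (-(p.Λ * (y + 1 / 8)))) (t := y) (by norm_num) (by positivity)
      (by linarith)
      ((h.measure_not_neverLow_le p _).trans (ENNReal.ofReal_le_ofReal (by linarith))) ?_ ?_
      (fun z h1 h2 => by rwa [← hy]) ?_
    · have h1 : Real.exp (-(p.Λ * (y + 1 / 8))) ≤ 1 := Real.exp_le_one_iff.2 (by nlinarith)
      -- A fictitious acceptance exactly at the level `θ` shows that the potential is at least `γ`.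
      have h2 : levelPotential p.Λ 0 1 ≤ summaryPotential p θ s - 0.3 *
          Real.exp (-(p.Λ * (y + 1 / 8))) := by
        rw [summaryPotential, hds]
        exact levelPotential_accept_far hΛ hj (by linarith) hdy.le (by linarith)
      have h3 := levelPotential_nonneg (d := 0) (by linarith : 0 ≤ p.Λ) le_rfl
      linarith
    · intro ω hω
      have hω' : NeverLow p μ (fun k => x k ω) s.2.2.1 := hω
      have hP : Passes p (fun k => x k ω) (s.2.1 + p.threshold s.2.2.1 (u ω)) s.2.2.1 := by
        refine hω'.passes ?_
        have h1 := p.threshold_le s.2.2.1 (u ω)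
        rw [hd, hy]
        nlinarith
      obtain ⟨-, h2, h3⟩ := summaryStep_passes (i := i) (s := s) (ξ := (fun k => x k ω, u ω)) hP
      rw [summaryPotential, summaryPotential, h2, h3, hds]
      refine levelPotential_accept_far hΛ hj (by linarith) hdy.le ?_
      have h4 := hω' _ (p.lastRound_mem hj)
      rw [div_le_iff₀ hε, hy]
      linarith
    · have h1 : Real.exp (-(64 * y ^ 2 * (p.Λ + 2 * Real.log s.2.2.1))) ≤
          Real.exp (-(8 * p.Λ)) * Real.exp (-(p.Λ * (y + 1 / 8))) := by
        rw [← Real.exp_add]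
        refine Real.exp_le_exp.2 ?_
        have h2 : y + 1 / 8 + 8 ≤ 64 * y ^ 2 := by nlinarith
        have h3 : 0 ≤ 64 * y ^ 2 * (2 * Real.log s.2.2.1) := by positivity
        nlinarith
      have h4 : 0 ≤ Real.exp (-(8 * p.Λ)) * Real.exp (-(p.Λ * (y + 1 / 8))) := by positivity
      rw [Params.riskWeight]
      nlinarith

/-- If the old estimate is below `μ - 5ε/8`, even `α = ε / 2` sets a level below `μ - ε / 8`. An arm
that is never low then passes and leaves an estimate above `μ - ε / 8`. -/
lemma IsArm.measure_summaryStep_lt_le (h : IsArm P μ x u) (p : Params) (i : Fin n)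
    (s : Summary n) (hj : 1 ≤ s.2.2.1) :
    P {ω | (summaryStep p i s (fun k => x k ω, u ω)).2.1 < μ - 5 / 8 * p.ε} ≤
      ENNReal.ofReal (2 * Real.exp (-p.Λ)) := by
  have hε := p.ε_pos
  refine (measure_mono fun ω hω hlow => ?_).trans (h.measure_not_neverLow_le p s.2.2.1)
  change (summaryStep p i s (fun k => x k ω, u ω)).2.1 < μ - 5 / 8 * p.ε at hω
  have h1 := (le_summaryStep_estimate p i s (fun k => x k ω, u ω) hj).trans_lt hω
  have hP : Passes p (fun k => x k ω) (s.2.1 + p.threshold s.2.2.1 (u ω)) s.2.2.1 := by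
    refine NeverLow.passes hlow ?_
    linarith [p.threshold_le s.2.2.1 (u ω)]
  rw [(summaryStep_passes (i := i) (s := s) (ξ := (fun k => x k ω, u ω)) hP).2.1] at hω
  linarith [hlow _ (p.lastRound_mem hj)]

end Step

/-! ### Probability of a wrong answer over the whole stream -/

section Stream

variable {n : ℕ} [NeZero n] {Ω : Type*} [MeasurableSpace Ω] {P : Measure Ω}
  [IsProbabilityMeasure P] {ν : Fin n → Measure ℝ} {X : Fin n → ℕ → Ω → ℝ} {U : Fin n → Ω → ℝ}

/-- Only the arrival of `a` matters, because later estimates never decrease; no union over the other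
arms is needed. -/
lemma IsStream.measure_summaryRun_lt_le (h : IsStream P ν X U) (p : Params) (a : Fin n)
    (l : List (Fin n)) (hl : (0 :: l).Nodup) (ha : a ∈ 0 :: l) :
    P {ω | (summaryRun p (fun i k => X i k ω) (fun i => U i ω) l).2.1 <
      mean (ν a) - 5 / 8 * p.ε} ≤ ENNReal.ofReal (2 * Real.exp (-p.Λ)) := by
  have hε := p.ε_pos
  induction l using List.reverseRecOn with
  | nil =>
    rw [List.mem_singleton] at ha
    subst ha
    refine (measure_mono fun ω hω => ?_).trans (((h.isArm 0).measure_avg_le (p.cumPulls 1)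
      (t := p.ε / 8) (by positivity)).trans (ENNReal.ofReal_le_ofReal
      ((p.exp_deviation_eighth_le le_rfl).trans ?_)))
    · change avg (fun k => X 0 k ω) (p.cumPulls 1) < _ at hω
      change avg (fun k => X 0 k ω) (p.cumPulls 1) ≤ _
      linarith
    · linarith [Real.exp_pos (-p.Λ), pow_one (Real.exp (-p.Λ))]
  | append_singleton l i ih =>
    rw [← List.cons_append, List.nodup_append] at hl
    rw [← List.cons_append, List.mem_append, List.mem_singleton] at ha
    rcases ha with ha | rfl
    · refine (measure_mono fun ω hω => ?_).trans (ih hl.1 ha)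
      change (summaryRun p (fun i k => X i k ω) (fun i => U i ω) (l ++ [i])).2.1 < _ at hω
      rw [summaryRun_append] at hω
      exact (le_summaryStep_estimate p i _ _ (summaryRun_counter p _ _ l)).trans_lt hω
    · have hi : a ∉ 0 :: l := fun hi => hl.2.2 a hi a (by simp) rfl
      have hT : MeasurableSet {s : Summary n | s.2.1 < mean (ν a) - 5 / 8 * p.ε} :=
        measurableSet_lt (by fun_prop) measurable_const
      have hrun : ∀ l, Measurable fun ω =>
          summaryRun p (fun i k => X i k ω) (fun i => U i ω) l := fun l =>
        measurable_summaryRun p l (fun i _ => h.measurable_reward i)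
          (fun i _ => h.measurable_number i)
      have h1 := h.lintegral_summaryRun_append p l hi (G := Set.indicator
        {s : Summary n | s.2.1 < mean (ν a) - 5 / 8 * p.ε} 1) (measurable_one.indicator hT)
      have h2 : ∀ f : Ω → Summary n, Measurable f → ∫⁻ ω, Set.indicator
          {s : Summary n | s.2.1 < mean (ν a) - 5 / 8 * p.ε} 1 (f ω) ∂P =
          P {ω | (f ω).2.1 < mean (ν a) - 5 / 8 * p.ε} := fun f hf =>
        lintegral_indicator_one (hf hT)
      rw [h2 _ (hrun _)] at h1
      rw [h1]
      calc _ ≤ ∫⁻ _, ENNReal.ofReal (2 * Real.exp (-p.Λ)) ∂P := by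
            refine lintegral_mono fun ω => ?_
            have h3 := (measurable_summaryStep p a).comp (Measurable.prodMk
              (measurable_const (a := summaryRun p (fun i k => X i k ω) (fun i => U i ω) l))
              ((measurable_pi_lambda _ (h.measurable_reward a)).prodMk (h.measurable_number a)))
            simp only [Function.comp_def] at h3
            refine (h2 _ h3).le.trans ?_
            exact (h.isArm a).measure_summaryStep_lt_le p a _ (summaryRun_counter p _ _ l)
        _ = _ := by rw [lintegral_const, measure_univ, mul_one]

lemma IsStream.measure_overrated_le (h : IsStream P ν X U) (p : Params) (bad : Set (Fin n))
    (θ : ℝ) (hbad : ∀ i ∈ bad, mean (ν i) + 3 / 8 * p.ε ≤ θ) (l : List (Fin n))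
    (hl : (0 :: l).Nodup) :
    P {ω | (summaryRun p (fun i k => X i k ω) (fun i => U i ω) l).1 ∈ bad ∧
      θ ≤ (summaryRun p (fun i k => X i k ω) (fun i => U i ω) l).2.1} ≤
      ENNReal.ofReal (13 * Real.exp (-p.Λ)) := by
  have hε := p.ε_pos
  have hΛ := p.four_le_Λ
  have hB := p.riskWeight_pos
  have hB4 : p.riskWeight ≤ 4 * Real.exp (-p.Λ) := by
    unfold Params.riskWeight
    gcongr
    linarith
  have hm := measurable_riskPotential p bad θ
  have hrun : Measurable fun ω => summaryRun p (fun i k => X i k ω) (fun i => U i ω) l :=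
    measurable_summaryRun p l (fun i _ => h.measurable_reward i) (fun i _ => h.measurable_number i)
  -- The constant `13` is `1` for the first arm being overrated plus `3 * 4` for the maximum `3` of
  -- the potential times the weight.
  have hinit : ∫⁻ ω, riskPotential p bad θ (summaryInit p fun k => X 0 k ω) ∂P ≤
      ENNReal.ofReal (13 * Real.exp (-p.Λ)) := by
    set A : Set Ω := {ω | mean (ν 0) + 3 / 8 * p.ε ≤ avg (fun k => X 0 k ω) (p.cumPulls 1)}
    have hAm : MeasurableSet A := measurableSet_le measurable_const
      ((measurable_avg _).comp (measurable_pi_lambda _ (h.measurable_reward 0)))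
    have hPA : P A ≤ ENNReal.ofReal (Real.exp (-p.Λ)) := by
      refine ((h.isArm 0).measure_le_avg _ (by positivity)).trans (ENNReal.ofReal_le_ofReal
        ((p.exp_deviation_le le_rfl (3 / 8)).trans (Real.exp_le_exp.2 ?_)))
      linarith
    have key : ∀ ω, riskPotential p bad θ (summaryInit p fun k => X 0 k ω) ≤
        A.indicator 1 ω + ENNReal.ofReal (3 * p.riskWeight) := by
      intro ω
      refine ENNReal.ofReal_add_le.trans (add_le_add ?_ (ENNReal.ofReal_le_ofReal ?_))
      · by_cases hω : ω ∈ A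
        · rw [Set.indicator_of_mem hω, Pi.one_apply, ← ENNReal.ofReal_one]
          exact ENNReal.ofReal_le_ofReal (overrated_le_one _ _ _)
        · rw [overrated, if_neg, ENNReal.ofReal_zero]
          · exact zero_le
          · rintro ⟨h1, h2⟩
            exact hω ((hbad 0 h1).trans h2)
      · have h1 : summaryPotential p θ (summaryInit p fun k => X 0 k ω : Summary n) ≤ 3 :=
          levelPotential_le (by linarith) le_rfl
        nlinarith
    refine (lintegral_mono key).trans ?_
    rw [lintegral_add_right _ measurable_const, lintegral_const, measure_univ, mul_one,
      lintegral_indicator_one hAm]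
    grw [hPA]
    rw [← ENNReal.ofReal_add (by positivity) (by positivity)]
    exact ENNReal.ofReal_le_ofReal (by linarith)
  have h1 := h.lintegral_summaryRun_le p hm 0 (fun i s hj => by
    rw [add_zero]
    exact (h.isArm i).lintegral_riskPotential_le p bad θ i (hbad i) s hj) l hl
  rw [mul_zero, add_zero] at h1
  refine le_trans ?_ (h1.trans hinit)
  -- Markov's inequality at `1`: an overrated final arm alone makes the risk potential at least `1`.
  have h2 := mul_meas_ge_le_lintegral (μ := P) (hm.comp hrun) 1
  rw [one_mul] at h2
  refine (measure_mono fun ω hω => ?_).trans h2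
  change 1 ≤ riskPotential p bad θ _
  have h3 := summaryPotential_nonneg p θ _
    (summaryRun_counter p (fun i k => X i k ω) (fun i => U i ω) l)
  rw [riskPotential, overrated, if_pos (by exact hω), ← ENNReal.ofReal_one]
  refine ENNReal.ofReal_le_ofReal ?_
  have := mul_nonneg hB.le h3
  linarith

lemma IsStream.le_measure_best (h : IsStream P ν X U) (p : Params) :
    ENNReal.ofReal (1 - p.δ) ≤ P {ω | ∀ i, mean (ν i) -
      mean (ν (run p (fun i k => X i k ω) (fun i => U i ω)).best) ≤ p.ε} := by
  have hδ := p.δ_pos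
  have hε := p.ε_pos
  have hC := p.C_ge
  obtain ⟨a, ha⟩ := Finite.exists_max fun i => mean (ν i)
  set l := (List.finRange n).tail with hl
  have hnd : (0 :: l).Nodup := finRange_nodup_cons n
  have hal : a ∈ 0 :: l := by
    rw [hl, zero_cons_finRange_tail]
    exact List.mem_finRange a
  have h1 := h.measure_summaryRun_lt_le p a l hnd hal
  have h2 := h.measure_overrated_le p {i | mean (ν i) < mean (ν a) - p.ε}
    (mean (ν a) - 5 / 8 * p.ε) (fun i hi => by
      rw [Set.mem_ofPred_eq] at hi
      linarith) l hnd
  set G : Set Ω := {ω | ∀ i, mean (ν i) -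
    mean (ν (run p (fun i k => X i k ω) (fun i => U i ω)).best) ≤ p.ε}
  have h3 : P Gᶜ ≤ ENNReal.ofReal p.δ := by
    refine (measure_mono ?_).trans ((measure_union_le _ _).trans ((add_le_add h1 h2).trans ?_))
    · intro ω hω
      simp only [G, Set.mem_compl_iff, Set.mem_ofPred_eq, not_forall, not_le] at hω
      obtain ⟨i, hi⟩ := hω
      rw [(run_spec p _ _).1.1] at hi
      rcases lt_or_ge (summaryRun p (fun i k => X i k ω) (fun i => U i ω) l).2.1
        (mean (ν a) - 5 / 8 * p.ε) with h4 | h4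
      · exact Or.inl h4
      · refine Or.inr ⟨?_, h4⟩
        rw [Set.mem_ofPred_eq]
        linarith [ha i]
    · rw [← ENNReal.ofReal_add (by positivity) (by positivity), p.exp_neg_Λ]
      refine ENNReal.ofReal_le_ofReal ?_
      -- The two error bounds add up to `15 * δ / C`, and `C ≥ 100`.
      rw [← add_mul, ← mul_div_assoc, div_le_iff₀ (by linarith)]
      nlinarith
  have h4 : (1 : ENNReal) ≤ P G + ENNReal.ofReal p.δ := by
    have h5 := measure_union_le (μ := P) G Gᶜ
    rw [Set.union_compl_self, measure_univ] at h5
    exact h5.trans (by gcongr)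
  rw [ENNReal.ofReal_sub _ hδ.le, ENNReal.ofReal_one]
  exact tsub_le_iff_right.2 h4

end Stream

end StreamingBAI

end

/-! ### Assembly of the theorem -/

theorem theorem1 (C : ℝ) (hC : 100 ≤ C) :
    ∃ K : ℝ, 0 < K ∧
      ∀ p : StreamingBAI.Params, p.C = C →
      ∀ (n : ℕ) [NeZero n]
        -- reward distributions of the arms, in order of arrival, supported on `[0, 1]`
        (ν : Fin n → Measure ℝ) (_ : ∀ i, IsProbabilityMeasure (ν i))
        (_ : ∀ i, ∀ᵐ x ∂(ν i), x ∈ Set.Icc (0 : ℝ) 1)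
        (Ω : Type*) [MeasurableSpace Ω] (P : Measure Ω) [IsProbabilityMeasure P]
        -- `X i m` is the reward of the `(m + 1)`-st pull of arm `i`;
        -- `U i` is the algorithm's random number used when arm `i` arrives
        (X : Fin n → ℕ → Ω → ℝ) (U : Fin n → Ω → ℝ)
        (_ : ∀ i m, Measurable (X i m)) (_ : ∀ i, Measurable (U i))
        (_ : ∀ i m, P.map (X i m) = ν i)
        (_ : ∀ i, P.map (U i) = volume.restrict (Set.Icc (0 : ℝ) 1))
        (_ : iIndepFun (Sum.elim (fun q : Fin n × ℕ => X q.1 q.2) U) P),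
        -- single pass, single-arm memory: the pulls are made in order of arrival, and no arm is
        -- pulled again after a pull of a later arm
        (∀ ω, (StreamingBAI.run p (fun i m => X i m ω) (fun i => U i ω)).log.Pairwise (· ≤ ·)) ∧
        -- the returned arm is `ε`-best with probability at least `1 - δ`
        ENNReal.ofReal (1 - p.δ) ≤
          P {ω | ∀ i, StreamingBAI.mean (ν i) - StreamingBAI.mean
            (ν (StreamingBAI.run p (fun i m => X i m ω) (fun i => U i ω)).best) ≤ p.ε} ∧
        -- expected number of pulls
        ∫⁻ ω, ((StreamingBAI.run p (fun i m => X i m ω) (fun i => U i ω)).log.length : ENNReal) ∂P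
          ≤ ENNReal.ofReal (K * (n / p.ε ^ 2 * (1 + Real.log (1 / p.δ)))) ∧
        (p.δ ≤ 1 / 2 →
          ∫⁻ ω, ((StreamingBAI.run p (fun i m => X i m ω) (fun i => U i ω)).log.length : ENNReal) ∂P
            ≤ ENNReal.ofReal (K * (n / p.ε ^ 2 * Real.log (1 / p.δ)))) := by
  have hlogC : 1 ≤ Real.log C := by
    rw [Real.le_log_iff_exp_le (by linarith)]
    linarith [Real.exp_one_lt_d9]
  refine ⟨2400 * Real.log C, by positivity, ?_⟩
  intro p hp n _ ν _ hsupp Ω _ P _ X U hX hU hmapX hmapU hind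
  have h : StreamingBAI.IsStream P ν X U := ⟨hsupp, hX, hU, hmapX, hmapU, hind⟩
  have hδ := p.δ_pos
  have hε := p.ε_pos
  have hΛ : p.Λ = Real.log C + Real.log (1 / p.δ) := by
    rw [StreamingBAI.Params.Λ, hp, ← Real.log_mul (by positivity) (by positivity),
      mul_one_div]
  have hlogδ : 0 ≤ Real.log (1 / p.δ) :=
    Real.log_nonneg (by rw [le_div_iff₀ hδ]; linarith [p.δ_lt_one])
  have hcost := h.lintegral_log_length_le p
  -- Both rates follow from `Λ = log C + log (1 / δ) ≤ 3 * log C * L`, with `L = 1 + log (1 / δ)`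
  -- or, as `log (1 / δ) ≥ 1 / 2` when `δ ≤ 1 / 2`, with `L = log (1 / δ)`. Then `3 * 780 ≤ 2400`.
  have hrate : ∀ L : ℝ, p.Λ ≤ 3 * Real.log C * L → 780 * n * p.scale ≤
      2400 * Real.log C * (n / p.ε ^ 2 * L) := by
    intro L hL
    have hn : (0 : ℝ) ≤ n / p.ε ^ 2 := by positivity
    have h1 : 780 * n * p.scale = 780 * (n / p.ε ^ 2) * p.Λ := by
      rw [StreamingBAI.Params.scale]
      ring
    have h2 := mul_le_mul_of_nonneg_left hL hn
    have h3 := mul_nonneg hn (by linarith [p.four_le_Λ] : 0 ≤ p.Λ)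
    rw [h1]
    linarith
  refine ⟨fun ω => (StreamingBAI.run_spec p _ _).2, h.le_measure_best p, ?_, fun hhalf => ?_⟩
  · refine hcost.trans (ENNReal.ofReal_le_ofReal (hrate _ ?_))
    rw [hΛ]
    nlinarith
  · refine hcost.trans (ENNReal.ofReal_le_ofReal (hrate _ ?_))
    have h2 : 1 / 2 ≤ Real.log (1 / p.δ) := by
      refine le_trans ?_ (Real.log_le_log (by norm_num : (0 : ℝ) < 2) ?_)
      · linarith [Real.log_two_gt_d9]
      · rw [le_div_iff₀ hδ]
        linarith
    rw [hΛ]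
    nlinarith
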